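/- Let $d\ge 1$ be an integer, $m\ge -d$ and $\nu>0$ real numbers, and let $L=-\Delta+|x|^2+m$ on $\mathbb{R}^d$. For a measurable $f:\mathbb{R}^d\to\mathbb{C}$ and $u>0$ put $$e^{-uL}f(x)=\int_{\mathbb{R}^d}h_u(x,y)f(y)\,dy,\qquad h_u(x,y)=e^{-um}\,[2\pi\sinh 2u]^{-d/2}\,e^{-\frac{|x-y|^2}{2\tanh 2u}-(\tanh u)\,x\cdot y},$$ and, for $t>0$, let $$P_tf(x)=\frac{t^{2\nu}}{4^\nu\Gamma(\nu)}\int_0^\infty e^{-\frac{t^2}{4u}}\,[e^{-uL}f](x)\,\frac{du}{u^{1+\nu}}$$ whenever this (double) integral converges absolutely. For $a>0$ let $P_a^*f(x)=\sup_{0<t<a}|P_tf(x)|$. Put $$\phi(y)=\frac{e^{-|y|^2/2}}{(1+|y|)^{\frac{d+m}{2}}[\ln(e+|y|)]^{1+\nu}}\ \text{ if } m>-d,\qquad \phi(y)=\frac{e^{-|y|^2/2}}{[\ln(e+|y|)]^{\nu}}\ \text{ if } m=-d.$$ A weight is a measurable function $w:\mathbb{R}^d\to\mathbb{R}$ with $w(x)>0$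 for almost every $x$, and $L^p(w)=L^p(\mathbb{R}^d,w(x)\,dx)$. **Theorem 2.** Let $1<p<\infty$, $p'=p/(p-1)$, and $a>0$ be fixed. Then, for a weight $w>0$, the condition $$\big\|w^{-1/p}\,\phi\big\|_{L^{p'}(\mathbb{R}^d)}<\infty$$ is equivalent to the existence of some weight $v>0$ such that $P_a^*$ is bounded from $L^p(w)$ to $L^p(v)$, that is: there is a constant $C<\infty$ such that, for every $f\in L^p(w)$, the integrals $P_tf(x)$ converge absolutely for all $0<t<a$ at almost every $x$, and $P_a^*f$ is measurable with $\|P_a^*f\|_{L^p(v)}\le C\,\|f\|_{L^p(w)}$. -/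

import Mathlib

open MeasureTheory Set
open scoped NNReal ENNReal

noncomputable section

namespace HermitePoisson

variable {d : ℕ}

/-- The Mehler kernel `h_v(x,y)`, `v > 0`: the integral kernel of the heat semigroup `e^{-vL}`
of the Hermite operator `L = -Δ + |x|² + m` on `ℝ^d`. -/
def mehlerKernel (m v : ℝ) (x y : EuclideanSpace ℝ (Fin d)) : ℝ :=
  Real.exp (-(v * m)) * (2 * Real.pi * Real.sinh (2 * v)) ^ (-((d : ℝ) / 2)) *
    Real.exp (-(‖x - y‖ ^ 2 / (2 * Real.tanh (2 * v))) - Real.tanh v * inner ℝ x y)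

/-- `e^{-vL} f (x) = ∫ h_v(x,y) f(y) dy`. -/
def heat (m v : ℝ) (f : EuclideanSpace ℝ (Fin d) → ℂ) (x : EuclideanSpace ℝ (Fin d)) : ℂ :=
  ∫ y, (mehlerKernel m v x y : ℂ) * f y

/-- The Poisson-like integral
`P_t f (x) = t^{2ν} / (4^ν Γ(ν)) ∫_0^∞ e^{-t²/(4u)} [e^{-uL} f](x) du / u^{1+ν}`. -/
def poisson (ν m t : ℝ) (f : EuclideanSpace ℝ (Fin d) → ℂ)
    (x : EuclideanSpace ℝ (Fin d)) : ℂ :=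
  ((t ^ (2 * ν) / (4 ^ ν * Real.Gamma ν) : ℝ) : ℂ) *
    ∫ u in Ioi (0 : ℝ), ((Real.exp (-(t ^ 2 / (4 * u))) / u ^ (1 + ν) : ℝ) : ℂ) * heat m u f x

/-- The (double) integral that defines `P_t f (x)` converges absolutely. -/
def PoissonConverges (ν m t : ℝ) (f : EuclideanSpace ℝ (Fin d) → ℂ)
    (x : EuclideanSpace ℝ (Fin d)) : Prop :=
  Integrable
    (fun q : ℝ × EuclideanSpace ℝ (Fin d) =>
      ((Real.exp (-(t ^ 2 / (4 * q.1))) / q.1 ^ (1 + ν) : ℝ) : ℂ) *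
        ((mehlerKernel m q.1 x q.2 : ℂ) * f q.2))
    ((volume.restrict (Ioi (0 : ℝ))).prod volume)

/-- The local maximal operator `P*_a f (x) = sup_{0<t<a} |P_t f (x)|`, with values in `[0,∞]`. -/
def localMaximal (ν m a : ℝ) (f : EuclideanSpace ℝ (Fin d) → ℂ)
    (x : EuclideanSpace ℝ (Fin d)) : ℝ≥0∞ :=
  ⨆ t ∈ Ioo (0 : ℝ) a, ‖poisson ν m t f x‖ₑ

/-- The function `φ`. The two cases are `m > -d` and `m = -d`. -/
def phi (ν m : ℝ) (y : EuclideanSpace ℝ (Fin d)) : ℝ :=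
  if -(d : ℝ) < m then
    Real.exp (-(‖y‖ ^ 2 / 2)) /
      ((1 + ‖y‖) ^ (((d : ℝ) + m) / 2) * Real.log (Real.exp 1 + ‖y‖) ^ (1 + ν))
  else
    Real.exp (-(‖y‖ ^ 2 / 2)) / Real.log (Real.exp 1 + ‖y‖) ^ ν

/-- A weight: a (Lebesgue) measurable function that is positive almost everywhere. -/
structure IsWeight (w : EuclideanSpace ℝ (Fin d) → ℝ) : Prop where
  aemeasurable : AEMeasurable w volume
  pos : ∀ᵐ x, 0 < w x

/-- The measure `w(x) dx`, so that `L^p(w)` is the `L^p` space of this measure. -/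
def weightMeasure (w : EuclideanSpace ℝ (Fin d) → ℝ) : Measure (EuclideanSpace ℝ (Fin d)) :=
  volume.withDensity fun x => ENNReal.ofReal (w x)

/-- `P*_a : L^p(w) → L^p(v)` boundedly: for every `f ∈ L^p(w)` the function `P*_a f` is defined
almost everywhere (through absolutely convergent integrals), it is measurable, and
`‖P*_a f‖_{L^p(v)} ≤ C ‖f‖_{L^p(w)}` with a finite constant `C` independent of `f`. -/
def MaximalBounded (ν m a p : ℝ) (w v : EuclideanSpace ℝ (Fin d) → ℝ) : Prop :=
  ∃ C : ℝ≥0, ∀ f : EuclideanSpace ℝ (Fin d) → ℂ,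
    MemLp f (ENNReal.ofReal p) (weightMeasure w) →
      (∀ᵐ x, ∀ t ∈ Ioo (0 : ℝ) a, PoissonConverges ν m t f x) ∧
      AEMeasurable (localMaximal ν m a f) volume ∧
      eLpNorm (localMaximal ν m a f) (ENNReal.ofReal p) (weightMeasure v) ≤
        C * eLpNorm f (ENNReal.ofReal p) (weightMeasure w)

end HermitePoisson

end

noncomputable section

namespace HermitePoisson

/-! With `s = tanh u`, the Mehler exponent is `-(|x|² + |y|²)/2` minus a remainder whose terms all
carry the factor `1 - s`, which is of order `e^{-2u}`. For bounded `x` and `u` away from `0` the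
kernel is therefore about `e^{-|y|²/2} e^{-(d+m)u}` once `e^{2u} ≥ |y|`, and it is cut off doubly
exponentially at earlier times. So `∫ e^{-(d+m)u} u^{-1-ν} du` effectively starts at `u =
log(e+|y|)/2`. For `d + m > 0` this gives `(1+|y|)^{-(d+m)/2} log^{-1-ν}`, and for `d + m = 0` the
whole tail counts and gives `log^{-ν}`. This is `φ`, as an upper bound
(`lintegral_large_poissonKernel_le`) and as a lower bound (`le_poissonE`).

Small times give Gaussian averages. Near `x` these are controlled by the Hardy–Littlewood maximal
function, and far from `x` again by `φ` (`poissonE_le`). Hence the positive maximal operator `T`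
maps `L¹(φ)` to weak `L¹` on every ball, and to weak `L¹(V)` for one positive weight `V`.

Let `ψ = (φ/w)^{1/(p-1)}`, the extremal function in Hölder's inequality. Then `ψ^p w = ψφ =
(w^{-1/p}φ)^{p'}`, so the condition of the theorem says `∫ ψφ < ∞`.

Sufficiency: `Tψ` is then finite almost everywhere. Since `F ≤ cψ` implies `TF ≤ c Tψ`, the operator
`F ↦ TF/(1+Tψ)` has a weighted `L^∞` bound, which is interpolated with the weak type estimate
(`lintegral_div_rpow_le_of_weak_type`). The resulting right side is a multiple of `∫ Fφ(F/ψ)^{p-1} =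
∫ F^p w`, so `v = V/(1+Tψ)^p` works.

Necessity: on the unit ball `P_{a/2}F ≥ c ∫ Fφ` for `F ≥ 0`. Testing on truncations of `ψ`, with `I
= ∫ ψφ` over the truncation, gives `c^p I^p v(B) ≤ C^p I`, a bound on `I` independent of the
truncation. -/

/-- The centred Hardy–Littlewood maximal function of an `ℝ≥0∞`-valued function. -/
def hardyLittlewood {E : Type*} [PseudoMetricSpace E] [MeasurableSpace E] (μ : Measure E)
    (G : E → ℝ≥0∞) (x : E) : ℝ≥0∞ :=
  ⨆ r ∈ Ioi (0 : ℝ), (∫⁻ y in Metric.closedBall x r, G y ∂μ) / μ (Metric.closedBall x r)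

/-! ### Weak type (1,1) of the Hardy–Littlewood maximal function -/

section HardyLittlewood

variable {E : Type*} [NormedAddCommGroup E] [NormedSpace ℝ E] [FiniteDimensional ℝ E]
  [MeasurableSpace E] (μ : Measure E) [μ.IsAddHaarMeasure]

theorem setLIntegral_closedBall_le_hardyLittlewood (G : E → ℝ≥0∞) (x : E) {r : ℝ} (hr : 0 < r) :
    ∫⁻ y in Metric.closedBall x r, G y ∂μ ≤
      μ (Metric.closedBall x r) * hardyLittlewood μ G x := by
  have h0 : μ (Metric.closedBall x r) ≠ 0 := (Metric.measure_closedBall_pos μ x hr).ne'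
  have h1 : μ (Metric.closedBall x r) ≠ ∞ := measure_closedBall_lt_top.ne
  rw [mul_comm, ← ENNReal.div_le_iff h0 h1]
  exact le_iSup₂ (f := fun (r : ℝ) (_ : r ∈ Ioi (0 : ℝ)) =>
    (∫⁻ y in Metric.closedBall x r, G y ∂μ) / μ (Metric.closedBall x r)) r hr

/-- The Hardy–Littlewood maximal function is of weak type `(1, 1)`. -/
theorem mul_measure_lt_hardyLittlewood_le [BorelSpace E] [Nontrivial E] (G : E → ℝ≥0∞) {l : ℝ≥0∞} (hl : l ≠ 0)
    (hl' : l ≠ ∞) :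
    l * μ {x | l < hardyLittlewood μ G x} ≤
      ENNReal.ofReal (4 ^ Module.finrank ℝ E) * ∫⁻ y, G y ∂μ := by
  set n := Module.finrank ℝ E with hn
  have hnpos : 0 < n := Module.finrank_pos
  rcases eq_or_ne (∫⁻ y, G y ∂μ) ∞ with hG | hG
  · rw [hG, ENNReal.mul_top (by simp)]; exact le_top
  set S := {x | l < hardyLittlewood μ G x} with hS
  have key : ∀ x : S, ∃ r : ℝ, 0 < r ∧
      l * μ (Metric.closedBall (x : E) r) ≤ ∫⁻ y in Metric.closedBall (x : E) r, G y ∂μ := by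
    rintro ⟨x, hx⟩
    simp only [hS, mem_ofPred_eq, hardyLittlewood, lt_iSup_iff] at hx
    obtain ⟨r, hr, h⟩ := hx
    refine ⟨r, hr, ?_⟩
    have h0 : μ (Metric.closedBall x r) ≠ 0 := (Metric.measure_closedBall_pos μ x hr).ne'
    have h1 : μ (Metric.closedBall x r) ≠ ∞ := measure_closedBall_lt_top.ne
    exact (ENNReal.le_div_iff_mul_le (Or.inl h0) (Or.inl h1)).1 h.le
  choose r hr hlr using key
  have hb0 : μ (Metric.ball (0 : E) 1) ≠ 0 := (Metric.measure_ball_pos μ 0 one_pos).ne'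
  have hbt : μ (Metric.ball (0 : E) 1) ≠ ∞ := measure_ball_lt_top.ne
  -- The covering lemma needs bounded radii. The integral of `G` is finite, so the volume of each
  -- selected ball is bounded, and `r ≤ r ^ n` when `r ≥ 1`.
  have hbound : ∀ x : S, r x ≤ 1 + ((∫⁻ y, G y ∂μ) / (l * μ (Metric.ball (0 : E) 1))).toReal := by
    intro x
    rcases le_total (r x) 1 with h1 | h1
    · exact h1.trans (le_add_of_nonneg_right ENNReal.toReal_nonneg)
    · have h2 : l * (ENNReal.ofReal (r x ^ n) * μ (Metric.ball (0 : E) 1)) ≤ ∫⁻ y, G y ∂μ := by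
        rw [← Measure.addHaar_closedBall μ (x : E) (hr x).le]
        exact (hlr x).trans (setLIntegral_le_lintegral _ _)
      have h3 : ENNReal.ofReal (r x ^ n) ≤ (∫⁻ y, G y ∂μ) / (l * μ (Metric.ball (0 : E) 1)) := by
        rw [ENNReal.le_div_iff_mul_le (Or.inl (mul_ne_zero hl hb0))
          (Or.inl (ENNReal.mul_ne_top hl' hbt))]
        calc _ = l * (ENNReal.ofReal (r x ^ n) * μ (Metric.ball (0 : E) 1)) := by ring
          _ ≤ _ := h2
      have h4 : r x ^ n ≤ ((∫⁻ y, G y ∂μ) / (l * μ (Metric.ball (0 : E) 1))).toReal :=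
        (ENNReal.ofReal_le_iff_le_toReal
          (ENNReal.div_ne_top hG (mul_ne_zero hl hb0))).1 h3
      have h5 : r x ≤ r x ^ n := le_self_pow₀ h1 hnpos.ne'
      linarith
  obtain ⟨u, -, hdisj, hcov⟩ := Vitali.exists_disjoint_subfamily_covering_enlargement_closedBall
    (univ : Set S) (fun x => (x : E)) r _ (fun x _ => hbound x) 4 (by norm_num)
  have hcount : u.Countable := by
    refine hdisj.countable_of_nonempty_interior fun x _ => ?_
    refine ⟨(x : E), ?_⟩
    exact interior_mono Metric.ball_subset_closedBall
      (by rw [Metric.isOpen_ball.interior_eq]; exact Metric.mem_ball_self (hr x))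
  have hsub : S ⊆ ⋃ b ∈ u, Metric.closedBall (b : E) (4 * r b) := by
    intro x hx
    obtain ⟨b, hb, hb'⟩ := hcov ⟨x, hx⟩ (mem_univ _)
    exact mem_iUnion₂.2 ⟨b, hb, hb' (Metric.mem_closedBall_self (hr _).le)⟩
  have : Countable u := hcount.to_subtype
  calc l * μ S ≤ l * ∑' b : u, μ (Metric.closedBall ((b : S) : E) (4 * r b)) := by
        gcongr
        exact (measure_mono hsub).trans (measure_biUnion_le μ hcount _)
    _ = ∑' b : u, l * μ (Metric.closedBall ((b : S) : E) (4 * r b)) := ENNReal.tsum_mul_left.symm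
    _ = ∑' b : u, ENNReal.ofReal (4 ^ n) * (l * μ (Metric.closedBall ((b : S) : E) (r b))) := by
        congr 1; ext b
        rw [Measure.addHaar_closedBall_mul μ _ (by norm_num : (0:ℝ) ≤ 4) (hr _).le, ← hn,
          Measure.addHaar_closedBall_center μ ((b : S) : E)]
        ring
    _ ≤ ∑' b : u, ENNReal.ofReal (4 ^ n) *
          ∫⁻ y in Metric.closedBall ((b : S) : E) (r b), G y ∂μ :=
        ENNReal.tsum_le_tsum fun b => by gcongr; exact hlr b
    _ = ENNReal.ofReal (4 ^ n) *
          ∑' b : u, ∫⁻ y in Metric.closedBall ((b : S) : E) (r b), G y ∂μ := ENNReal.tsum_mul_left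
    _ = ENNReal.ofReal (4 ^ n) *
          ∫⁻ y in ⋃ b ∈ u, Metric.closedBall ((b : S) : E) (r b), G y ∂μ := by
        rw [lintegral_biUnion hcount (fun _ _ => Metric.isClosed_closedBall.measurableSet) hdisj]
    _ ≤ _ := mul_le_mul_right (setLIntegral_le_lintegral _ _) _

end HardyLittlewood

/-! ### Exponential bounds and Gaussian averages -/

theorem rpow_le_mul_exp {b c : ℝ} (hb : 0 ≤ b) (hc : 0 < c) :
    ∃ C : ℝ, 0 < C ∧ ∀ y : ℝ, 0 ≤ y → y ^ b ≤ C * Real.exp (c * y) := by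
  rcases hb.eq_or_lt with rfl | hb
  · exact ⟨1, one_pos, fun y hy => by simpa using by positivity⟩
  · refine ⟨(b / c) ^ b, by positivity, fun y hy => ?_⟩
    have h : y ≤ b / c * Real.exp (c * y / b) := by
      have h1 : c * y / b ≤ Real.exp (c * y / b) := by linarith [Real.add_one_le_exp (c * y / b)]
      calc y = b / c * (c * y / b) := by field_simp
        _ ≤ _ := by gcongr
    calc y ^ b ≤ (b / c * Real.exp (c * y / b)) ^ b := Real.rpow_le_rpow hy h hb.le
      _ = _ := by
        rw [Real.mul_rpow (by positivity) (by positivity), ← Real.exp_mul]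
        congr 2; field_simp

/-- The single term `k = ⌊s⌋₊` suffices. With `s = ‖x - y‖² / (4u)` this writes a Gaussian as a
superposition of indicators of balls centred at `x`. -/
theorem exp_neg_le_tsum {s : ℝ} (hs : 0 ≤ s) :
    ENNReal.ofReal (Real.exp (-s)) ≤
      ∑' k : ℕ, (Iic ((k : ℝ) + 1)).indicator (fun _ => ENNReal.ofReal (Real.exp (-k))) s := by
  refine le_trans ?_ (ENNReal.le_tsum ⌊s⌋₊)
  rw [indicator_of_mem (mem_Iic.2 (Nat.lt_floor_add_one s).le)]
  gcongr
  exact Nat.floor_le hs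

/-- Gaussian averages are dominated by the Hardy–Littlewood maximal function. -/
theorem lintegral_gaussian_le_hardyLittlewood (d : ℕ) :
    ∃ C : ℝ≥0, ∀ (u : ℝ), 0 < u → ∀ (G : EuclideanSpace ℝ (Fin d) → ℝ≥0∞), Measurable G → ∀ x,
      ∫⁻ y, ENNReal.ofReal (u ^ (-((d : ℝ) / 2)) * Real.exp (-(‖x - y‖ ^ 2 / (4 * u)))) * G y ≤
        C * hardyLittlewood volume G x := by
  obtain ⟨C₁, hC₁, hC⟩ := rpow_le_mul_exp (b := (d : ℝ) / 2) (c := 1 / 8) (by positivity)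
    (by norm_num)
  set E := EuclideanSpace ℝ (Fin d)
  set q : ℕ → ℝ := fun k => Real.exp (-k) * (4 * ((k : ℝ) + 1)) ^ ((d : ℝ) / 2) with hq
  have hq0 : ∀ k, 0 ≤ q k := fun k => by positivity
  have hsum : Summable q := by
    refine Summable.of_nonneg_of_le hq0 (fun k => ?_)
      ((Real.summable_exp_nat_mul_iff.2 (by norm_num : (-(1 / 2) : ℝ) < 0)).mul_left
        (C₁ * Real.exp (1 / 2)))
    calc q k ≤ Real.exp (-k) * (C₁ * Real.exp (1 / 8 * (4 * ((k : ℝ) + 1)))) := by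
          simp only [hq]; gcongr; exact hC _ (by positivity)
      _ = C₁ * (Real.exp (-k) * Real.exp (1 / 8 * (4 * ((k : ℝ) + 1)))) := by ring
      _ = C₁ * (Real.exp (1 / 2) * Real.exp (k * -(1 / 2))) := by
          rw [← Real.exp_add, ← Real.exp_add]; congr 2; ring
      _ = _ := by ring
  set V := volume (Metric.ball (0 : E) 1)
  have hV : V ≠ ∞ := measure_ball_lt_top.ne
  have hfin : (∑' k, ENNReal.ofReal (q k)) * V ≠ ∞ :=
    ENNReal.mul_ne_top hsum.tsum_ofReal_ne_top hV
  refine ⟨((∑' k, ENNReal.ofReal (q k)) * V).toNNReal, fun u hu G hG x => ?_⟩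
  rw [ENNReal.coe_toNNReal hfin]
  -- The ball of radius `r k` is the set where the Gaussian exponent is at most `k + 1`. Its volume
  -- is proportional to `u ^ (d/2)`, which cancels the normalisation and makes the bound uniform in
  -- `u`.
  set r : ℕ → ℝ := fun k => Real.sqrt (4 * u * (k + 1)) with hr
  have hrpos : ∀ k, 0 < r k := fun k => Real.sqrt_pos.2 (by positivity)
  have hmem : ∀ (k : ℕ) (y : E), ‖x - y‖ ^ 2 / (4 * u) ∈ Iic ((k : ℝ) + 1) ↔ y ∈ Metric.closedBall x (r k) := by
    intro k y
    rw [mem_Iic, Metric.mem_closedBall, dist_comm, dist_eq_norm, hr, Real.le_sqrt (norm_nonneg _)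
      (by positivity), div_le_iff₀ (by positivity)]
    constructor <;> intro h <;> linarith
  have hrk : ∀ k : ℕ, u ^ (-((d : ℝ) / 2)) * Real.exp (-k) * r k ^ d = q k := by
    intro k
    have : r k ^ d = u ^ ((d : ℝ) / 2) * (4 * ((k : ℝ) + 1)) ^ ((d : ℝ) / 2) := by
      rw [← Real.mul_rpow hu.le (by positivity), show r k = Real.sqrt (4 * u * (k + 1)) from rfl,
        Real.sqrt_eq_rpow, ← Real.rpow_natCast,
        ← Real.rpow_mul (by positivity)]
      congr 1 <;> ring
    rw [this, Real.rpow_neg hu.le]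
    have : u ^ ((d : ℝ) / 2) ≠ 0 := by positivity
    simp only [hq]; field_simp
  calc ∫⁻ y, ENNReal.ofReal (u ^ (-((d : ℝ) / 2)) * Real.exp (-(‖x - y‖ ^ 2 / (4 * u)))) * G y
      ≤ ∫⁻ y, ∑' k : ℕ, ENNReal.ofReal (u ^ (-((d : ℝ) / 2)) * Real.exp (-k)) *
          (Metric.closedBall x (r k)).indicator G y := by
        refine lintegral_mono fun y => ?_
        rw [ENNReal.ofReal_mul (by positivity), mul_assoc]
        calc _ ≤ ENNReal.ofReal (u ^ (-((d : ℝ) / 2))) * ((∑' k : ℕ, (Iic ((k : ℝ) + 1)).indicator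
              (fun _ => ENNReal.ofReal (Real.exp (-k))) (‖x - y‖ ^ 2 / (4 * u))) * G y) := by
              gcongr; exact exp_neg_le_tsum (by positivity)
          _ = _ := by
            rw [← ENNReal.tsum_mul_right, ← ENNReal.tsum_mul_left]
            congr 1; ext k
            rw [ENNReal.ofReal_mul (by positivity), mul_assoc]
            congr 1
            by_cases h : y ∈ Metric.closedBall x (r k)
            · rw [indicator_of_mem h, indicator_of_mem ((hmem k y).2 h)]
            · rw [indicator_of_notMem h, indicator_of_notMem (fun h' => h ((hmem k y).1 h'))]
              simp
    _ = ∑' k : ℕ, ENNReal.ofReal (u ^ (-((d : ℝ) / 2)) * Real.exp (-k)) *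
          ∫⁻ y in Metric.closedBall x (r k), G y := by
        rw [lintegral_tsum fun k => by
          exact ((hG.indicator Metric.isClosed_closedBall.measurableSet).const_mul _).aemeasurable]
        congr 1; ext k
        rw [lintegral_const_mul _ (hG.indicator Metric.isClosed_closedBall.measurableSet),
          lintegral_indicator Metric.isClosed_closedBall.measurableSet]
    _ ≤ ∑' k : ℕ, ENNReal.ofReal (u ^ (-((d : ℝ) / 2)) * Real.exp (-k)) *
          (ENNReal.ofReal (r k ^ d) * V * hardyLittlewood volume G x) := by
        refine ENNReal.tsum_le_tsum fun k => ?_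
        gcongr
        refine (setLIntegral_closedBall_le_hardyLittlewood volume G x (hrpos k)).trans_eq ?_
        rw [Measure.addHaar_closedBall _ _ (hrpos k).le, finrank_euclideanSpace_fin]
    _ = ∑' k : ℕ, ENNReal.ofReal (q k) * (V * hardyLittlewood volume G x) := by
        congr 1; ext k
        rw [← hrk, ENNReal.ofReal_mul (p := u ^ (-((d : ℝ) / 2)) * Real.exp (-k)) (by positivity)]
        ring
    _ = _ := by rw [ENNReal.tsum_mul_right]; ring

/-! ### Hyperbolic tangent -/

section Hyperbolic

theorem tanh_eq_one_sub (u : ℝ) : Real.tanh u = 1 - 2 / (Real.exp (2 * u) + 1) := by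
  have h : Real.exp (2 * u) = Real.exp u * Real.exp u := by rw [← Real.exp_add]; ring_nf
  have h1 : Real.exp (-u) = (Real.exp u)⁻¹ := Real.exp_neg u
  have h2 : Real.exp u ≠ 0 := (Real.exp_pos u).ne'
  rw [Real.tanh_eq_sinh_div_cosh, Real.sinh_eq, Real.cosh_eq, h, h1]
  have h3 : Real.exp u * Real.exp u + 1 ≠ 0 := by positivity
  field_simp
  ring

theorem tanh_two_mul (u : ℝ) : Real.tanh (2 * u) = 2 * Real.tanh u / (1 + Real.tanh u ^ 2) := by
  have := (Real.cosh_pos u).ne'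
  rw [Real.tanh_eq_sinh_div_cosh, Real.tanh_eq_sinh_div_cosh, Real.sinh_two_mul,
    Real.cosh_two_mul]
  have h : Real.cosh u ^ 2 + Real.sinh u ^ 2 ≠ 0 := by positivity
  field_simp

theorem tanh_pos_of_pos {u : ℝ} (hu : 0 < u) : 0 < Real.tanh u := by
  rw [Real.tanh_eq_sinh_div_cosh]
  exact div_pos (Real.sinh_pos_iff.2 hu) (Real.cosh_pos u)

theorem tanh_le_tanh_of_le {u v : ℝ} (h : u ≤ v) : Real.tanh u ≤ Real.tanh v := by
  rw [tanh_eq_one_sub, tanh_eq_one_sub]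
  gcongr

/-- The function `v cosh v - sinh v` vanishes at `0` and has derivative `v sinh v ≥ 0`. -/
theorem tanh_le_self {u : ℝ} (hu : 0 ≤ u) : Real.tanh u ≤ u := by
  have h : MonotoneOn (fun v : ℝ => v * Real.cosh v - Real.sinh v) (Ici 0) := by
    refine monotoneOn_of_deriv_nonneg (convex_Ici 0) (by fun_prop) (by fun_prop) fun v hv => ?_
    rw [interior_Ici] at hv
    have : HasDerivAt (fun v : ℝ => v * Real.cosh v - Real.sinh v)
        (1 * Real.cosh v + v * Real.sinh v - Real.cosh v) v :=
      ((hasDerivAt_id' v).mul (Real.hasDerivAt_cosh v)).sub (Real.hasDerivAt_sinh v)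
    rw [this.deriv]
    have : 0 ≤ v * Real.sinh v := mul_nonneg (le_of_lt hv) (Real.sinh_nonneg_iff.2 (le_of_lt hv))
    linarith
  have := h self_mem_Ici hu hu
  simp only [zero_mul, Real.sinh_zero, sub_zero] at this
  rw [Real.tanh_eq_sinh_div_cosh, div_le_iff₀ (Real.cosh_pos u)]
  linarith

end Hyperbolic

/-! ### Bounds for the Mehler kernel -/

section Mehler

variable {d : ℕ}

local notation "E" d => EuclideanSpace ℝ (Fin d)

theorem mehlerKernel_nonneg (m : ℝ) {u : ℝ} (hu : 0 < u) (x y : E d) :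
    0 ≤ mehlerKernel m u x y := by
  have : 0 < Real.sinh (2 * u) := Real.sinh_pos_iff.2 (by linarith)
  unfold mehlerKernel
  positivity

/-- Comes from `tanh 2u = 2s/(1+s²)` with `s = tanh u`. Both squares now have the same sign, so
dropping the second leaves a Gaussian upper bound. -/
theorem mehler_exponent {u : ℝ} (hu : 0 < u) (x y : E d) :
    -(‖x - y‖ ^ 2 / (2 * Real.tanh (2 * u))) - Real.tanh u * inner ℝ x y =
      -(‖x - y‖ ^ 2 / (4 * Real.tanh u) + Real.tanh u * ‖x + y‖ ^ 2 / 4) := by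
  have hs := (tanh_pos_of_pos hu).ne'
  rw [tanh_two_mul, norm_sub_sq_real, norm_add_sq_real]
  generalize Real.tanh u = s at hs
  have : 1 + s ^ 2 ≠ 0 := by positivity
  field_simp
  ring

/-- Splits off the exponent `(‖x‖² + ‖y‖²)/2` of the ground state, which is the limit as `u → ∞`.
Everything left has the small factor `1 - tanh u`. -/
theorem mehler_exponent' {u : ℝ} (hu : 0 < u) (x y : E d) :
    ‖x - y‖ ^ 2 / (4 * Real.tanh u) + Real.tanh u * ‖x + y‖ ^ 2 / 4 =
      (‖x‖ ^ 2 + ‖y‖ ^ 2) / 2 + ((1 - Real.tanh u) ^ 2 * (‖x‖ ^ 2 + ‖y‖ ^ 2) -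
        2 * (1 - Real.tanh u) * (1 + Real.tanh u) * inner ℝ x y) / (4 * Real.tanh u) := by
  have hs := (tanh_pos_of_pos hu).ne'
  rw [norm_sub_sq_real, norm_add_sq_real]
  generalize Real.tanh u = s at hs
  field_simp
  ring

/-- Gaussian bound for small times. -/
theorem mehlerKernel_le_gaussian (m : ℝ) {u : ℝ} (hu : 0 < u) (hu1 : u ≤ 1) (x y : E d) :
    mehlerKernel m u x y ≤
      Real.exp |m| * (u ^ (-((d : ℝ) / 2)) * Real.exp (-(‖x - y‖ ^ 2 / (4 * u)))) := by
  have hsinh : 2 * u ≤ Real.sinh (2 * u) := Real.self_le_sinh_iff.2 (by linarith)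
  have hs := tanh_pos_of_pos hu
  rw [mehlerKernel, mehler_exponent hu, ← mul_assoc]
  gcongr Real.exp ?_ * ?_ * Real.exp ?_
  · have : -(u * m) ≤ u * |m| := by
      rw [← mul_neg]; exact mul_le_mul_of_nonneg_left (neg_le_abs m) hu.le
    exact this.trans (mul_le_of_le_one_left (abs_nonneg m) hu1)
  · refine Real.rpow_le_rpow_of_nonpos hu ?_ (neg_nonpos.2 (by positivity))
    nlinarith [Real.pi_gt_three]
  · have h1 : ‖x - y‖ ^ 2 / (4 * u) ≤ ‖x - y‖ ^ 2 / (4 * Real.tanh u) := by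
      gcongr; exact tanh_le_self hu.le
    have h2 : 0 ≤ Real.tanh u * ‖x + y‖ ^ 2 / 4 := by positivity
    linarith

/-- The threshold `1/8` is where `2π sinh 2u ≥ e^{2u}` is available: `e^{2u} ≥ 5/4` gives `2 sinh 2u
≥ (9/25) e^{2u}`, and `π > 3` more than compensates. -/
theorem prefactor_le (d : ℕ) (m : ℝ) {u : ℝ} (hu : 1 / 8 ≤ u) :
    Real.exp (-(u * m)) * (2 * Real.pi * Real.sinh (2 * u)) ^ (-((d : ℝ) / 2)) ≤
      Real.exp (-((d + m) * u)) := by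
  have h1 : Real.exp (2 * u) ≤ 2 * Real.pi * Real.sinh (2 * u) := by
    have h3 := Real.pi_gt_three
    have h4 : 0 < Real.exp (-(2 * u)) := Real.exp_pos _
    have h5 : Real.exp (-(2 * u)) * Real.exp (2 * u) = 1 := by
      rw [← Real.exp_add]; simp
    have h6 : (5 / 4 : ℝ) ≤ Real.exp (2 * u) := by
      linarith [Real.add_one_le_exp (2 * u)]
    have h7 : 2 * Real.sinh (2 * u) = Real.exp (2 * u) - Real.exp (-(2 * u)) := by
      rw [Real.sinh_eq]; ring
    have h8 : Real.exp (-(2 * u)) * (25 / 16) ≤ Real.exp (2 * u) := by nlinarith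
    nlinarith
  have h2 : (2 * Real.pi * Real.sinh (2 * u)) ^ (-((d : ℝ) / 2)) ≤
      Real.exp (2 * u) ^ (-((d : ℝ) / 2)) :=
    Real.rpow_le_rpow_of_nonpos (Real.exp_pos _) h1 (neg_nonpos.2 (by positivity))
  calc _ ≤ Real.exp (-(u * m)) * Real.exp (2 * u) ^ (-((d : ℝ) / 2)) := by gcongr
    _ = _ := by rw [← Real.exp_mul, ← Real.exp_add]; congr 1; ring

theorem le_prefactor (d : ℕ) (m : ℝ) {u : ℝ} (hu : 0 < u) :
    Real.pi ^ (-((d : ℝ) / 2)) * Real.exp (-((d + m) * u)) ≤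
      Real.exp (-(u * m)) * (2 * Real.pi * Real.sinh (2 * u)) ^ (-((d : ℝ) / 2)) := by
  have hsinh : 0 < Real.sinh (2 * u) := Real.sinh_pos_iff.2 (by linarith)
  have h1 : 2 * Real.pi * Real.sinh (2 * u) ≤ Real.pi * Real.exp (2 * u) := by
    have h7 : 2 * Real.sinh (2 * u) = Real.exp (2 * u) - Real.exp (-(2 * u)) := by
      rw [Real.sinh_eq]; ring
    nlinarith [Real.pi_pos, Real.exp_pos (-(2 * u)), mul_pos Real.pi_pos (Real.exp_pos (-(2 * u)))]
  calc _ = Real.exp (-(u * m)) * (Real.pi * Real.exp (2 * u)) ^ (-((d : ℝ) / 2)) := by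
        rw [Real.mul_rpow Real.pi_pos.le (Real.exp_pos _).le, ← Real.exp_mul, mul_left_comm,
          ← Real.exp_add]
        congr 2; ring
    _ ≤ _ := by
        gcongr 1
        exact Real.rpow_le_rpow_of_nonpos (by have := Real.pi_pos; positivity) h1
          (neg_nonpos.2 (by positivity))

/-- Bound for large times, locally uniform in `x`. -/
theorem mehlerKernel_le_of_large (d : ℕ) (m : ℝ) {N : ℝ} (hN : 0 ≤ N) :
    ∃ C : ℝ, 0 < C ∧ ∀ u : ℝ, 1 / 8 ≤ u → ∀ x y : E d, ‖x‖ ≤ N →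
      mehlerKernel m u x y ≤ C * (Real.exp (-(‖y‖ ^ 2 / 2)) *
        (Real.exp (-((d + m) * u)) * Real.exp (-(Real.exp (-(4 * u)) * ‖y‖ ^ 2 / 8)))) := by
  have hs0 := tanh_pos_of_pos (u := 1 / 8) (by norm_num)
  refine ⟨Real.exp (2 * N ^ 2 / Real.tanh (1 / 8)), Real.exp_pos _, fun u hu x y hx => ?_⟩
  have hu0 : 0 < u := by linarith
  rw [mehlerKernel, mehler_exponent hu0, mehler_exponent' hu0]
  have key : -((‖x‖ ^ 2 + ‖y‖ ^ 2) / 2 + ((1 - Real.tanh u) ^ 2 * (‖x‖ ^ 2 + ‖y‖ ^ 2) -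
        2 * (1 - Real.tanh u) * (1 + Real.tanh u) * inner ℝ x y) / (4 * Real.tanh u)) ≤
      2 * N ^ 2 / Real.tanh (1 / 8) + -(‖y‖ ^ 2 / 2) +
        -(Real.exp (-(4 * u)) * ‖y‖ ^ 2 / 8) := by
    have hs := tanh_pos_of_pos hu0
    have hs1 : Real.tanh (1 / 8) ≤ Real.tanh u := tanh_le_tanh_of_le hu
    have hδ : Real.exp (-(2 * u)) ≤ 1 - Real.tanh u := by
      rw [tanh_eq_one_sub, Real.exp_neg, sub_sub_cancel, inv_eq_one_div,
        div_le_div_iff₀ (Real.exp_pos _) (by positivity)]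
      have : 1 ≤ Real.exp (2 * u) := Real.one_le_exp (by linarith)
      linarith
    have hδ' : Real.exp (-(4 * u)) ≤ (1 - Real.tanh u) ^ 2 := by
      have : Real.exp (-(4 * u)) = Real.exp (-(2 * u)) ^ 2 := by
        rw [← Real.exp_nat_mul]; congr 1; push_cast; ring
      rw [this]
      gcongr
    have hslt : Real.tanh u < 1 := Real.tanh_lt_one u
    have hip : (inner ℝ x y : ℝ) ≤ N * ‖y‖ :=
      (real_inner_le_norm x y).trans (by gcongr)
    have hfrac : 2 * N ^ 2 / Real.tanh u ≤ 2 * N ^ 2 / Real.tanh (1 / 8) := by gcongr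
    generalize Real.tanh u = s at *
    have h1 : 2 * (1 - s) * (1 + s) * inner ℝ x y ≤ 4 * ((1 - s) * (N * ‖y‖)) := by
      have h2 : (1 - s) * (1 + s) * inner ℝ x y ≤ (1 - s) * (1 + s) * (N * ‖y‖) :=
        mul_le_mul_of_nonneg_left hip (mul_nonneg (by linarith) (by linarith))
      have h3 : (1 - s) * (N * ‖y‖) * (1 + s) ≤ (1 - s) * (N * ‖y‖) * 2 :=
        mul_le_mul_of_nonneg_left (by linarith) (mul_nonneg (by linarith) (by positivity))
      linarith
    -- Young's inequality: the cross term uses up half of the quadratic term. The other half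
    -- provides the cutoff `e^{-4u}‖y‖²/8`, and the remainder `8N²/(4s)` goes into the constant.
    have h4 : 4 * ((1 - s) * (N * ‖y‖)) ≤ (1 - s) ^ 2 * ‖y‖ ^ 2 / 2 + 8 * N ^ 2 := by
      nlinarith [sq_nonneg ((1 - s) * ‖y‖ - 4 * N)]
    have h5 : ((1 - s) ^ 2 * ‖y‖ ^ 2 / 2 - 8 * N ^ 2) / (4 * s) ≤
        ((1 - s) ^ 2 * (‖x‖ ^ 2 + ‖y‖ ^ 2) - 2 * (1 - s) * (1 + s) * inner ℝ x y) / (4 * s) := by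
      refine div_le_div_of_nonneg_right ?_ (by positivity)
      nlinarith [mul_nonneg (sq_nonneg (1 - s)) (sq_nonneg ‖x‖)]
    have h6 : ((1 - s) ^ 2 * ‖y‖ ^ 2 / 2 - 8 * N ^ 2) / (4 * s) =
        (1 - s) ^ 2 * ‖y‖ ^ 2 / (8 * s) - 2 * N ^ 2 / s := by
      field_simp; ring
    have h7 : Real.exp (-(4 * u)) * ‖y‖ ^ 2 / 8 ≤ (1 - s) ^ 2 * ‖y‖ ^ 2 / (8 * s) := by
      have : (0 : ℝ) < 8 * s := by linarith
      gcongr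
      linarith
    nlinarith [sq_nonneg ‖x‖]
  calc _ ≤ Real.exp (-((d + m) * u)) * Real.exp (2 * N ^ 2 / Real.tanh (1 / 8) +
        -(‖y‖ ^ 2 / 2) + -(Real.exp (-(4 * u)) * ‖y‖ ^ 2 / 8)) := by
        gcongr ?_ * Real.exp ?_
        exact prefactor_le d m hu
    _ = _ := by rw [Real.exp_add, Real.exp_add]; ring

/-- Lower bound for large times. -/
theorem le_mehlerKernel (d : ℕ) (m : ℝ) :
    ∃ c : ℝ, 0 < c ∧ ∀ u : ℝ, 1 / 2 ≤ u → ∀ x y : E d, ‖x‖ ≤ 1 →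
      ‖y‖ ≤ Real.exp (2 * u) →
      c * (Real.exp (-(‖y‖ ^ 2 / 2)) * Real.exp (-((d + m) * u))) ≤ mehlerKernel m u x y := by
  have hs0 := tanh_pos_of_pos (u := 1 / 2) (by norm_num)
  have hpi := Real.pi_pos
  -- The `1/2` bounds `‖x‖²/2`. In the remainder, `13 = 1 + 4 + 8` adds the bounds for the `‖x‖²`
  -- term, the `‖y‖²` term and the inner product; the last two rest on `(1 - tanh u)‖y‖ ≤ 2`.
  refine ⟨Real.pi ^ (-((d : ℝ) / 2)) * Real.exp (-(1 / 2 + 13 / (4 * Real.tanh (1 / 2)))),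
    by positivity, fun u hu x y hx hy => ?_⟩
  have hu0 : 0 < u := by linarith
  rw [mehlerKernel, mehler_exponent hu0, mehler_exponent' hu0]
  have key : -(1 / 2 + 13 / (4 * Real.tanh (1 / 2))) + -(‖y‖ ^ 2 / 2) ≤
      -((‖x‖ ^ 2 + ‖y‖ ^ 2) / 2 + ((1 - Real.tanh u) ^ 2 * (‖x‖ ^ 2 + ‖y‖ ^ 2) -
        2 * (1 - Real.tanh u) * (1 + Real.tanh u) * inner ℝ x y) / (4 * Real.tanh u)) := by
    have hs := tanh_pos_of_pos hu0
    have hs1 : Real.tanh (1 / 2) ≤ Real.tanh u := tanh_le_tanh_of_le hu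
    have hδ : (1 - Real.tanh u) * ‖y‖ ≤ 2 := by
      rw [tanh_eq_one_sub, sub_sub_cancel, div_mul_eq_mul_div, div_le_iff₀ (by positivity)]
      linarith
    have hslt : Real.tanh u < 1 := Real.tanh_lt_one u
    have hip : -‖y‖ ≤ (inner ℝ x y : ℝ) := by
      have h1 := (abs_le.1 (abs_real_inner_le_norm x y)).1
      have h2 : ‖x‖ * ‖y‖ ≤ 1 * ‖y‖ := by gcongr
      linarith
    have hfrac : 13 / (4 * Real.tanh u) ≤ 13 / (4 * Real.tanh (1 / 2)) := by gcongr
    generalize Real.tanh u = s at *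
    have hx2 : ‖x‖ ^ 2 ≤ 1 := pow_le_one₀ (norm_nonneg x) hx
    have hy2 : (1 - s) ^ 2 * ‖y‖ ^ 2 ≤ 4 := by
      have h0 : 0 ≤ (1 - s) * ‖y‖ := mul_nonneg (by linarith) (norm_nonneg y)
      nlinarith
    have hs2 : (1 - s) ^ 2 * ‖x‖ ^ 2 ≤ 1 :=
      mul_le_one₀ (pow_le_one₀ (by linarith) (by linarith)) (sq_nonneg _) hx2
    have h3 : -(2 * (1 - s) * (1 + s) * inner ℝ x y) ≤ 8 := by
      have h4 : (1 - s) * (1 + s) * (-inner ℝ x y) ≤ (1 - s) * (1 + s) * ‖y‖ :=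
        mul_le_mul_of_nonneg_left (by linarith) (mul_nonneg (by linarith) (by linarith))
      have h5 : (1 + s) * ((1 - s) * ‖y‖) ≤ 2 * 2 :=
        mul_le_mul (by linarith) hδ (mul_nonneg (by linarith) (norm_nonneg y)) (by norm_num)
      linarith
    have h6 : ((1 - s) ^ 2 * (‖x‖ ^ 2 + ‖y‖ ^ 2) - 2 * (1 - s) * (1 + s) * inner ℝ x y) / (4 * s)
        ≤ 13 / (4 * s) := by
      gcongr
      linarith
    linarith
  calc _ = (Real.pi ^ (-((d : ℝ) / 2)) * Real.exp (-((d + m) * u))) *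
        Real.exp (-(1 / 2 + 13 / (4 * Real.tanh (1 / 2))) + -(‖y‖ ^ 2 / 2)) := by
        rw [Real.exp_add]; ring
    _ ≤ _ := by
        gcongr ?_ * Real.exp ?_
        exact le_prefactor d m hu0

end Mehler

/-! ### The time integral and the radial decay of `φ` -/

section Decay

/-- The polynomial and logarithmic factor of `φ` as a function of the radius, where `κ = d + m`. -/
def decay (ν κ r : ℝ) : ℝ :=
  if 0 < κ then 1 / ((1 + r) ^ (κ / 2) * Real.log (Real.exp 1 + r) ^ (1 + ν))
  else 1 / Real.log (Real.exp 1 + r) ^ ν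

theorem phi_eq_mul_decay {d : ℕ} (ν m : ℝ) (y : EuclideanSpace ℝ (Fin d)) :
    phi ν m y = Real.exp (-(‖y‖ ^ 2 / 2)) * decay ν (d + m) ‖y‖ := by
  have : -(d : ℝ) < m ↔ 0 < (d : ℝ) + m := neg_lt_iff_pos_add'
  simp only [phi, decay, this]
  split_ifs <;> ring

theorem one_le_log_exp_add {r : ℝ} (hr : 0 ≤ r) : 1 ≤ Real.log (Real.exp 1 + r) := by
  rw [Real.le_log_iff_exp_le (by positivity)]
  linarith

theorem decay_pos (ν κ : ℝ) {r : ℝ} (hr : 0 ≤ r) : 0 < decay ν κ r := by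
  have := one_le_log_exp_add hr
  unfold decay
  split_ifs <;> positivity

theorem measurable_decay (ν κ : ℝ) : Measurable (decay ν κ) := by
  unfold decay
  split_ifs <;> fun_prop

/-- The factor `decay` is at least a negative power of `e + r`, so it dominates every exponential
decay. This absorbs the contributions that are not sharp. -/
theorem exp_neg_le_decay {ν κ : ℝ} (hν : 0 < ν) (hκ : 0 ≤ κ) {c : ℝ} (hc : 0 < c) :
    ∃ C : ℝ, 0 < C ∧ ∀ r : ℝ, 0 ≤ r →
      Real.exp (-(c * (Real.exp 1 + r))) ≤ C * decay ν κ r := by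
  obtain ⟨C, hC, h⟩ := rpow_le_mul_exp (b := κ / 2 + (1 + ν)) (by positivity) hc
  refine ⟨C, hC, fun r hr => ?_⟩
  have hl := one_le_log_exp_add hr
  have he : 1 ≤ Real.exp 1 := Real.one_le_exp zero_le_one
  have hY : 0 < Real.exp 1 + r := by positivity
  have hlY : Real.log (Real.exp 1 + r) ≤ Real.exp 1 + r := (Real.log_le_self hY.le)
  have key : 1 ≤ (Real.exp 1 + r) ^ (κ / 2 + (1 + ν)) * decay ν κ r := by
    rw [Real.rpow_add hY]
    unfold decay
    split_ifs with h0
    · rw [mul_one_div, one_le_div (by positivity)]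
      gcongr
    · rw [mul_one_div, one_le_div (by positivity)]
      have h1 : 1 ≤ (Real.exp 1 + r) ^ (κ / 2) := Real.one_le_rpow (by linarith) (by positivity)
      calc Real.log (Real.exp 1 + r) ^ ν ≤ Real.log (Real.exp 1 + r) ^ (1 + ν) :=
            Real.rpow_le_rpow_of_exponent_le hl (by linarith)
        _ ≤ (Real.exp 1 + r) ^ (1 + ν) := by gcongr
        _ ≤ _ := le_mul_of_one_le_left (by positivity) h1
  rw [Real.exp_neg, inv_le_iff_one_le_mul₀ (Real.exp_pos _)]
  calc 1 ≤ _ := key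
    _ ≤ C * Real.exp (c * (Real.exp 1 + r)) * decay ν κ r := by
      have := (decay_pos ν κ hr).le
      gcongr
      exact h _ hY.le
    _ = _ := by ring

theorem lintegral_Ioi_rpow {ν c : ℝ} (hν : 0 < ν) (hc : 0 < c) :
    ∫⁻ u in Ioi c, ENNReal.ofReal (u ^ (-(1 + ν))) = ENNReal.ofReal (c ^ (-ν) / ν) := by
  have h : -(1 + ν) < -1 := by linarith
  rw [← ofReal_integral_eq_lintegral_ofReal (integrableOn_Ioi_rpow_of_lt h hc)
    ((ae_restrict_mem measurableSet_Ioi).mono fun u hu =>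
      Real.rpow_nonneg (hc.trans hu).le _), integral_Ioi_rpow_of_lt h hc]
  congr 1
  rw [show -(1 + ν) + 1 = -ν by ring, neg_div_neg_eq]

theorem lintegral_exp_neg_abs_lt_top {c : ℝ} (hc : 0 < c) :
    ∫⁻ z, ENNReal.ofReal (Real.exp (-(c * |z|))) < ∞ := by
  have h : Integrable fun z : ℝ => Real.exp (-(c * |z|)) := by
    rw [← integrableOn_univ, ← Iic_union_Ioi (a := (0 : ℝ))]
    refine IntegrableOn.union ?_ ?_
    · refine (integrableOn_exp_mul_Iic hc 0).congr_fun (fun z hz => ?_) measurableSet_Iic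
      simp [abs_of_nonpos (mem_Iic.1 hz)]
    · refine (integrableOn_exp_mul_Ioi (neg_lt_zero.2 hc) 0).congr_fun (fun z hz => ?_)
        measurableSet_Ioi
      simp [abs_of_pos (mem_Ioi.1 hz)]
  exact h.lintegral_lt_top

/-- Recentres time at `log(e+r)/2`, because `e^{-4(u - log(e+r)/2)} = e^{-4u}(e+r)²`. The loss from
`1/8` to `1/16` and the constant come from `(e+r)² ≤ 2r² + 2e²`. -/
theorem exp_neg_sq_le {r u : ℝ} (hr : 0 ≤ r) (hu : 0 ≤ u) :
    Real.exp (-(Real.exp (-(4 * u)) * r ^ 2 / 8)) ≤ Real.exp (Real.exp 1 ^ 2 / 8) *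
      Real.exp (-(1 / 16 * Real.exp (-4 * (u - Real.log (Real.exp 1 + r) / 2)))) := by
  have hY : 0 < Real.exp 1 + r := by positivity
  have h1 : Real.exp (-4 * (u - Real.log (Real.exp 1 + r) / 2)) =
      Real.exp (-(4 * u)) * (Real.exp 1 + r) ^ 2 := by
    rw [show -4 * (u - Real.log (Real.exp 1 + r) / 2) =
      -(4 * u) + (2 : ℕ) * Real.log (Real.exp 1 + r) by push_cast; ring, Real.exp_add,
      Real.exp_nat_mul, Real.exp_log hY]
  rw [h1, ← Real.exp_add]
  gcongr
  have h2 : Real.exp (-(4 * u)) ≤ 1 := Real.exp_le_one_iff.2 (by linarith)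
  have h3 : (Real.exp 1 + r) ^ 2 ≤ 2 * r ^ 2 + 2 * Real.exp 1 ^ 2 := by
    nlinarith [sq_nonneg (r - Real.exp 1)]
  have h4 := mul_le_mul_of_nonneg_left h3 (Real.exp_pos (-(4 * u))).le
  have h5 := mul_le_mul_of_nonneg_right h2 (sq_nonneg (Real.exp 1))
  linarith

/-- Put `z = u - l/2` with `l = log(e+r)`. For `z ≥ 0` the factor `e^{-κz}` decays; for `z ≤ 0` its
growth is beaten by the double exponential. Both sides give `e^{-κ|z|}`, and half of this rate pays
for replacing `u^{-(1+ν)}` by `l^{-(1+ν)}`. -/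
theorem integrand_le_of_pos {ν κ : ℝ} (hν : 0 < ν) (hκ : 0 < κ) :
    ∃ C : ℝ, 0 < C ∧ ∀ r u : ℝ, 0 ≤ r → 1 / 8 ≤ u →
      Real.exp (-(κ * u)) * Real.exp (-(Real.exp (-(4 * u)) * r ^ 2 / 8)) * u ^ (-(1 + ν)) ≤
        C * decay ν κ r * Real.exp (-(κ / 2 * |u - Real.log (Real.exp 1 + r) / 2|)) := by
  obtain ⟨C₁, hC₁, h₁⟩ := rpow_le_mul_exp (b := κ / 2) (c := 1 / 16) (by positivity) (by norm_num)
  obtain ⟨C₂, hC₂, h₂⟩ := rpow_le_mul_exp (b := 1 + ν) (c := κ / 32) (by positivity)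
    (by positivity)
  refine ⟨Real.exp (Real.exp 1 ^ 2 / 8) * max 1 C₁ * (C₂ * Real.exp (κ / 16)), by positivity,
    fun r u hr hu => ?_⟩
  have hl := one_le_log_exp_add hr
  have hu0 : 0 < u := by linarith
  have hY : 0 < Real.exp 1 + r := by positivity
  have he := exp_neg_sq_le hr hu0.le
  have hdecay : Real.exp (-(κ * (Real.log (Real.exp 1 + r) / 2))) *
      Real.log (Real.exp 1 + r) ^ (-(1 + ν)) ≤ decay ν κ r := by
    have h1 : Real.exp (κ * (Real.log (Real.exp 1 + r) / 2)) = (Real.exp 1 + r) ^ (κ / 2) := by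
      rw [Real.rpow_def_of_pos hY]; congr 1; ring
    rw [decay, if_pos hκ, Real.exp_neg, h1, Real.rpow_neg (by linarith), ← mul_inv,
      ← one_div]
    have : 1 ≤ Real.exp 1 := Real.one_le_exp zero_le_one
    gcongr
  set l := Real.log (Real.exp 1 + r)
  obtain ⟨z, rfl⟩ : ∃ z, u = z + l / 2 := ⟨u - l / 2, by ring⟩
  rw [add_sub_cancel_right] at *
  have hz : Real.exp (-(κ * z)) * Real.exp (-(1 / 16 * Real.exp (-4 * z))) ≤
      max 1 C₁ * Real.exp (-(κ * |z|)) := by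
    rcases le_total 0 z with hz | hz
    · rw [abs_of_nonneg hz, mul_comm]
      gcongr
      exact (Real.exp_le_one_iff.2 (neg_nonpos.2 (by positivity))).trans (le_max_left _ _)
    · rw [abs_of_nonpos hz]
      have h3 := h₁ (Real.exp (-4 * z)) (Real.exp_pos _).le
      rw [← Real.exp_mul] at h3
      have h4 : Real.exp (-(κ * z)) = Real.exp (-4 * z * (κ / 2)) * Real.exp (-(κ * -z)) := by
        rw [← Real.exp_add]; congr 1; ring
      rw [h4, mul_right_comm]
      gcongr
      rw [Real.exp_neg, ← div_eq_mul_inv, div_le_iff₀ (Real.exp_pos _)]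
      exact h3.trans (by gcongr; exact le_max_right _ _)
  have hpow : (z + l / 2) ^ (-(1 + ν)) ≤
      C₂ * Real.exp (κ / 16) * Real.exp (κ / 2 * |z|) * l ^ (-(1 + ν)) := by
    -- Here `l = 2u - 2z ≤ 2u + 2|z|`, and `u ≥ 1/8` gives `2|z| ≤ 16|z|u`.
    have h5 : l / (z + l / 2) ≤ 2 + 16 * |z| := by
      rw [div_le_iff₀ hu0]
      nlinarith [neg_abs_le z, abs_nonneg z]
    have h6 : (l / (z + l / 2)) ^ (1 + ν) ≤ C₂ * Real.exp (κ / 32 * (2 + 16 * |z|)) :=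
      (Real.rpow_le_rpow (by positivity) h5 (by positivity)).trans (h₂ _ (by positivity))
    rw [Real.div_rpow (by positivity) hu0.le] at h6
    rw [Real.rpow_neg hu0.le, Real.rpow_neg (by positivity), mul_assoc C₂, ← Real.exp_add,
      ← div_eq_mul_inv, le_div_iff₀ (by positivity), mul_comm, ← div_eq_mul_inv]
    refine h6.trans_eq ?_
    congr 2; ring
  calc Real.exp (-(κ * (z + l / 2))) * Real.exp (-(Real.exp (-(4 * (z + l / 2))) * r ^ 2 / 8)) *
        (z + l / 2) ^ (-(1 + ν))
      ≤ Real.exp (-(κ * (z + l / 2))) * (Real.exp (Real.exp 1 ^ 2 / 8) *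
        Real.exp (-(1 / 16 * Real.exp (-4 * z)))) *
          (C₂ * Real.exp (κ / 16) * Real.exp (κ / 2 * |z|) * l ^ (-(1 + ν))) := by gcongr
    _ = Real.exp (Real.exp 1 ^ 2 / 8) * (C₂ * Real.exp (κ / 16)) *
        (Real.exp (-(κ * z)) * Real.exp (-(1 / 16 * Real.exp (-4 * z)))) * Real.exp (κ / 2 * |z|) *
          (Real.exp (-(κ * (l / 2))) * l ^ (-(1 + ν))) := by
        rw [mul_add, neg_add, Real.exp_add]; ring
    _ ≤ Real.exp (Real.exp 1 ^ 2 / 8) * (C₂ * Real.exp (κ / 16)) *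
        (max 1 C₁ * Real.exp (-(κ * |z|))) * Real.exp (κ / 2 * |z|) * decay ν κ r := by gcongr
    _ = Real.exp (Real.exp 1 ^ 2 / 8) * (C₂ * Real.exp (κ / 16)) * max 1 C₁ * decay ν κ r *
        (Real.exp (-(κ * |z|)) * Real.exp (κ / 2 * |z|)) := by ring
    _ = _ := by
        rw [← Real.exp_add]
        have : -(κ * |z|) + κ / 2 * |z| = -(κ / 2 * |z|) := by ring
        rw [this]; ring

/-- For `κ > 0` the integrand is concentrated around `u = log(e+r)/2`. For `κ = 0` no exponential
factor helps at infinity and the size is that of the full tail of `u^{-(1+ν)}`. -/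
theorem lintegral_large_le {ν κ : ℝ} (hν : 0 < ν) (hκ : 0 ≤ κ) :
    ∃ C : ℝ≥0, ∀ r : ℝ, 0 ≤ r →
      ∫⁻ u in Ioi (1 / 8 : ℝ), ENNReal.ofReal (Real.exp (-(κ * u)) *
        Real.exp (-(Real.exp (-(4 * u)) * r ^ 2 / 8)) * u ^ (-(1 + ν))) ≤
          C * ENNReal.ofReal (decay ν κ r) := by
  rcases hκ.eq_or_lt with rfl | hκ
  · obtain ⟨C₁, hC₁, h₁⟩ := rpow_le_mul_exp (b := ν) (c := 1 / 16) hν.le (by norm_num)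
    set K := Real.exp (Real.exp 1 ^ 2 / 8)
    have hK : 0 < K := Real.exp_pos _
    set A : ℝ := (1 / 4 : ℝ) ^ (-ν) / ν + C₁ * ((1 / 8 : ℝ) ^ (-ν) / ν)
    have hA : 0 ≤ A := by positivity
    refine ⟨(K * A).toNNReal, fun r hr => ?_⟩
    have hl := one_le_log_exp_add hr
    have hd : decay ν 0 r = Real.log (Real.exp 1 + r) ^ (-ν) := by
      rw [decay, if_neg (lt_irrefl _), Real.rpow_neg (by linarith), one_div]
    have he := fun u hu => exp_neg_sq_le (u := u) hr hu
    rw [hd]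
    set l := Real.log (Real.exp 1 + r)
    have hl0 : 0 < l := by linarith
    -- Split at `u = l/4`. Beyond it the tail integral is a multiple of `l^{-ν}`; before it `-4(u -
    -- l/2) ≥ l`, so the cutoff is below `e^{-l/16}`, hence below a multiple of `l^{-ν}`.
    have hpt : ∀ u ∈ Ioi (1 / 8 : ℝ), ENNReal.ofReal (Real.exp (-(0 * u)) *
        Real.exp (-(Real.exp (-(4 * u)) * r ^ 2 / 8)) * u ^ (-(1 + ν))) ≤
        ENNReal.ofReal K * ((Ioi (l / 4)).indicator
          (fun u => ENNReal.ofReal (u ^ (-(1 + ν)))) u +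
          ENNReal.ofReal (C₁ * l ^ (-ν)) * ENNReal.ofReal (u ^ (-(1 + ν)))) := by
      intro u hu
      have hu0 : 0 < u := lt_trans (by norm_num) hu
      have h3 := he u hu0.le
      by_cases h : u ∈ Ioi (l / 4)
      · rw [indicator_of_mem h]
        refine le_trans ?_ (mul_le_mul_right le_self_add _)
        rw [← ENNReal.ofReal_mul hK.le]
        refine ENNReal.ofReal_le_ofReal (mul_le_mul_of_nonneg_right ?_ (by positivity))
        simp only [zero_mul, neg_zero, Real.exp_zero, one_mul]
        refine h3.trans (mul_le_of_le_one_right hK.le ?_)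
        exact Real.exp_le_one_iff.2 (neg_nonpos.2 (by positivity))
      · rw [indicator_of_notMem h, zero_add, ← ENNReal.ofReal_mul (by positivity),
          ← ENNReal.ofReal_mul hK.le, ← mul_assoc]
        refine ENNReal.ofReal_le_ofReal (mul_le_mul_of_nonneg_right ?_ (by positivity))
        simp only [zero_mul, neg_zero, Real.exp_zero, one_mul]
        refine h3.trans (mul_le_mul_of_nonneg_left ?_ hK.le)
        have h4 : u ≤ l / 4 := not_lt.1 h
        have h5 : l ≤ Real.exp (-4 * (u - l / 2)) := by
          have := Real.add_one_le_exp (-4 * (u - l / 2))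
          linarith
        have h6 := (h₁ l hl0.le).trans (mul_le_mul_of_nonneg_left
          (Real.exp_le_exp.2 (mul_le_mul_of_nonneg_left h5 (by norm_num : (0 : ℝ) ≤ 1 / 16))) hC₁.le)
        rw [Real.exp_neg, Real.rpow_neg hl0.le, ← div_eq_mul_inv, le_div_iff₀ (by positivity),
          inv_mul_le_iff₀ (Real.exp_pos _), mul_comm]
        exact h6
    calc _ ≤ ∫⁻ u in Ioi (1 / 8 : ℝ), ENNReal.ofReal K * ((Ioi (l / 4)).indicator
          (fun u => ENNReal.ofReal (u ^ (-(1 + ν)))) u +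
          ENNReal.ofReal (C₁ * l ^ (-ν)) * ENNReal.ofReal (u ^ (-(1 + ν)))) :=
          setLIntegral_mono' measurableSet_Ioi hpt
      _ ≤ ENNReal.ofReal K * (ENNReal.ofReal ((l / 4) ^ (-ν) / ν) +
          ENNReal.ofReal (C₁ * l ^ (-ν)) * ENNReal.ofReal ((1 / 8 : ℝ) ^ (-ν) / ν)) := by
          rw [lintegral_const_mul _ (by measurability), lintegral_add_right _ (by fun_prop),
            lintegral_const_mul _ (by fun_prop), lintegral_Ioi_rpow hν (by norm_num)]
          refine mul_le_mul_right (add_le_add ?_ le_rfl) _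
          rw [← lintegral_Ioi_rpow hν (by positivity : 0 < l / 4),
            ← lintegral_indicator (measurableSet_Ioi (a := l / 4))]
          exact setLIntegral_le_lintegral _ _
      _ = ENNReal.ofReal (K * A * l ^ (-ν)) := by
          rw [← ENNReal.ofReal_mul (by positivity), ← ENNReal.ofReal_add (by positivity)
            (by positivity), ← ENNReal.ofReal_mul hK.le, div_eq_mul_one_div l 4,
            Real.mul_rpow hl0.le (by norm_num)]
          congr 1
          simp only [A]; ring
      _ = _ := by rw [ENNReal.ofReal_mul (by positivity)]; rfl
  · obtain ⟨C, hC, h⟩ := integrand_le_of_pos hν hκ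
    have hfin := lintegral_exp_neg_abs_lt_top (half_pos hκ)
    refine ⟨(ENNReal.ofReal C *
      ∫⁻ z, ENNReal.ofReal (Real.exp (-(κ / 2 * |z|)))).toNNReal, fun r hr => ?_⟩
    rw [ENNReal.coe_toNNReal (ENNReal.mul_ne_top ENNReal.ofReal_ne_top hfin.ne)]
    have hd := (decay_pos ν κ hr).le
    calc _ ≤ ∫⁻ u in Ioi (1 / 8 : ℝ), ENNReal.ofReal (C * decay ν κ r) *
          ENNReal.ofReal (Real.exp (-(κ / 2 * |u - Real.log (Real.exp 1 + r) / 2|))) := by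
          refine setLIntegral_mono' measurableSet_Ioi fun u hu => ?_
          rw [← ENNReal.ofReal_mul (by positivity)]
          exact ENNReal.ofReal_le_ofReal (h r u hr (le_of_lt hu))
      _ ≤ ∫⁻ u, ENNReal.ofReal (C * decay ν κ r) *
          ENNReal.ofReal (Real.exp (-(κ / 2 * |u - Real.log (Real.exp 1 + r) / 2|))) :=
          setLIntegral_le_lintegral _ _
      _ = _ := by
          rw [lintegral_const_mul _ (by fun_prop), lintegral_sub_right_eq_self
            (fun z => ENNReal.ofReal (Real.exp (-(κ / 2 * |z|)))), ENNReal.ofReal_mul hC.le]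
          ring

/-- For `κ > 0` the unit interval to the right of `l/2`, with `l = log(e+r)`, already carries enough
mass: there `u ≤ 2l`, as `l ≥ 1`, and `e^{-κu}` loses at most `e^{-κ}`. For `κ = 0` the tail is
computed exactly. -/
theorem le_lintegral_large {ν κ : ℝ} (hν : 0 < ν) (hκ : 0 ≤ κ) :
    ∃ c : ℝ, 0 < c ∧ ∀ r : ℝ, 0 ≤ r → ENNReal.ofReal (c * decay ν κ r) ≤
      ∫⁻ u in Ioi (Real.log (Real.exp 1 + r) / 2),
        ENNReal.ofReal (Real.exp (-(κ * u)) * u ^ (-(1 + ν))) := by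
  rcases hκ.eq_or_lt with rfl | hκ
  · refine ⟨(1 / 2 : ℝ) ^ (-ν) / ν, by positivity, fun r hr => ?_⟩
    have hl := one_le_log_exp_add hr
    rw [decay, if_neg (lt_irrefl _)]
    simp only [zero_mul, neg_zero, Real.exp_zero, one_mul]
    rw [lintegral_Ioi_rpow hν (by linarith), one_div (Real.log _ ^ _), ← Real.rpow_neg (by linarith),
      div_eq_mul_one_div (Real.log _) (2 : ℝ), Real.mul_rpow (by linarith) (by norm_num)]
    exact le_of_eq (congrArg _ (by ring))
  · refine ⟨Real.exp (-κ) * 3 ^ (-(κ / 2)) * 2 ^ (-(1 + ν)), by positivity, fun r hr => ?_⟩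
    have hl := one_le_log_exp_add hr
    have hY : 0 < Real.exp 1 + r := by positivity
    have hY3 : Real.exp 1 + r ≤ 3 * (1 + r) := by linarith [Real.exp_one_lt_three]
    have h1 : Real.exp (-(κ * (Real.log (Real.exp 1 + r) / 2))) =
        (Real.exp 1 + r) ^ (-(κ / 2)) := by
      rw [Real.rpow_def_of_pos hY]; congr 1; ring
    have h2 : (3 * (1 + r)) ^ (-(κ / 2)) ≤ (Real.exp 1 + r) ^ (-(κ / 2)) :=
      Real.rpow_le_rpow_of_nonpos hY hY3 (neg_nonpos.2 (by positivity))
    rw [decay, if_pos hκ]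
    set l := Real.log (Real.exp 1 + r)
    have hpt : ∀ u ∈ Ioc (l / 2) (l / 2 + 1), Real.exp (-κ) * 3 ^ (-(κ / 2)) * 2 ^ (-(1 + ν)) *
        (1 / ((1 + r) ^ (κ / 2) * l ^ (1 + ν))) ≤ Real.exp (-(κ * u)) * u ^ (-(1 + ν)) := by
      intro u hu
      have hu0 : 0 < u := by linarith [hu.1]
      calc _ = Real.exp (-κ) * (3 * (1 + r)) ^ (-(κ / 2)) * (2 * l) ^ (-(1 + ν)) := by
            rw [Real.mul_rpow (by norm_num) (by positivity), Real.mul_rpow (by norm_num)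
              (by positivity), Real.rpow_neg (by positivity : 0 ≤ 1 + r),
              Real.rpow_neg (by positivity : 0 ≤ l), one_div, mul_inv]
            ring
        _ ≤ Real.exp (-κ) * Real.exp (-(κ * (l / 2))) * u ^ (-(1 + ν)) := by
            rw [h1]
            gcongr ?_ * ?_ * ?_
            exact Real.rpow_le_rpow_of_nonpos hu0 (by linarith [hu.2])
              (neg_nonpos.2 (by positivity))
        _ ≤ _ := by
            rw [← Real.exp_add]
            gcongr
            nlinarith [hu.2]
    calc _ = ∫⁻ u in Ioc (l / 2) (l / 2 + 1), ENNReal.ofReal (Real.exp (-κ) * 3 ^ (-(κ / 2)) *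
          2 ^ (-(1 + ν)) * (1 / ((1 + r) ^ (κ / 2) * l ^ (1 + ν)))) := by
          rw [setLIntegral_const, Real.volume_Ioc]
          simp
      _ ≤ ∫⁻ u in Ioc (l / 2) (l / 2 + 1),
          ENNReal.ofReal (Real.exp (-(κ * u)) * u ^ (-(1 + ν))) :=
          setLIntegral_mono' measurableSet_Ioc fun u hu => ENNReal.ofReal_le_ofReal (hpt u hu)
      _ ≤ _ := lintegral_mono_set Ioc_subset_Ioi_self

end Decay

/-! ### The positive Poisson operator and its kernel -/

section Operator

variable {d : ℕ}

local notation "E" d => EuclideanSpace ℝ (Fin d)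

theorem measurable_mehlerKernel (m : ℝ) :
    Measurable fun z : ℝ × (E d) × (E d) => mehlerKernel m z.1 z.2.1 z.2.2 := by
  have h : Measurable Real.tanh := by
    have : Real.tanh = fun u => Real.sinh u / Real.cosh u :=
      funext Real.tanh_eq_sinh_div_cosh
    rw [this]; fun_prop
  unfold mehlerKernel
  fun_prop

/-- The positive operator on `ℝ≥0∞`-valued functions that has the same kernel as `poisson`. -/
def poissonE (ν m t : ℝ) (F : (E d) → ℝ≥0∞) (x : E d) : ℝ≥0∞ :=
  ENNReal.ofReal (t ^ (2 * ν) / (4 ^ ν * Real.Gamma ν)) *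
    ∫⁻ u in Ioi (0 : ℝ), ENNReal.ofReal (Real.exp (-(t ^ 2 / (4 * u))) / u ^ (1 + ν)) *
      ∫⁻ y, ENNReal.ofReal (mehlerKernel m u x y) * F y

variable (ν m t : ℝ)

theorem measurable_heatE {F : (E d) → ℝ≥0∞} (hF : Measurable F) :
    Measurable fun z : ℝ × (E d) => ∫⁻ y, ENNReal.ofReal (mehlerKernel m z.1 z.2 y) * F y := by
  have h : Measurable fun z : (ℝ × (E d)) × (E d) =>
      ENNReal.ofReal (mehlerKernel m z.1.1 z.1.2 z.2) * F z.2 :=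
    ((measurable_mehlerKernel m).comp (g := fun z : ℝ × (E d) × (E d) =>
      mehlerKernel m z.1 z.2.1 z.2.2) (f := fun z : (ℝ × (E d)) × (E d) => (z.1.1, z.1.2, z.2))
      (by fun_prop)).ennreal_ofReal.mul (hF.comp measurable_snd)
  exact h.lintegral_prod_right'

theorem measurable_heatE_left {F : (E d) → ℝ≥0∞} (hF : Measurable F) (x : E d) :
    Measurable fun u : ℝ => ∫⁻ y, ENNReal.ofReal (mehlerKernel m u x y) * F y :=
  (measurable_heatE m hF).comp (f := fun u : ℝ => (u, x)) (by fun_prop)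

theorem measurable_mehlerKernel_right (u : ℝ) (x : E d) :
    Measurable fun y => mehlerKernel m u x y :=
  (measurable_mehlerKernel m).comp (f := fun y => (u, x, y)) (by fun_prop)

theorem measurable_poissonWeight :
    Measurable fun u : ℝ => ENNReal.ofReal (Real.exp (-(t ^ 2 / (4 * u))) / u ^ (1 + ν)) := by
  fun_prop

theorem measurable_poissonE {F : (E d) → ℝ≥0∞} (hF : Measurable F) :
    Measurable (poissonE ν m t F) := by
  have h : Measurable fun z : (E d) × ℝ =>
      ENNReal.ofReal (Real.exp (-(t ^ 2 / (4 * z.2))) / z.2 ^ (1 + ν)) *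
      ∫⁻ y, ENNReal.ofReal (mehlerKernel m z.2 z.1 y) * F y :=
    ((measurable_poissonWeight ν t).comp measurable_snd).mul
      ((measurable_heatE m hF).comp measurable_swap)
  exact h.lintegral_prod_right'.const_mul _

theorem poissonE_mono {F G : (E d) → ℝ≥0∞} (h : F ≤ G) (x : E d) :
    poissonE ν m t F x ≤ poissonE ν m t G x := by
  unfold poissonE
  gcongr
  exact h _

theorem poissonE_add {F G : (E d) → ℝ≥0∞} (hF : Measurable F) (x : E d) :
    poissonE ν m t (F + G) x = poissonE ν m t F x + poissonE ν m t G x := by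
  unfold poissonE
  rw [← mul_add, ← lintegral_add_left]
  · congr 2; ext u
    rw [← mul_add, ← lintegral_add_left]
    · simp only [Pi.add_apply, mul_add]
    · exact (measurable_mehlerKernel_right m u x).ennreal_ofReal.mul hF
  · exact (measurable_poissonWeight ν t).mul (measurable_heatE_left m hF x)

theorem poissonE_const_mul {F : (E d) → ℝ≥0∞} (hF : Measurable F) (c : ℝ≥0∞) (x : E d) :
    poissonE ν m t (fun y => c * F y) x = c * poissonE ν m t F x := by
  unfold poissonE
  have h : Measurable fun u : ℝ => ENNReal.ofReal (Real.exp (-(t ^ 2 / (4 * u))) / u ^ (1 + ν)) *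
      ∫⁻ y, ENNReal.ofReal (mehlerKernel m u x y) * F y :=
    (measurable_poissonWeight ν t).mul (measurable_heatE_left m hF x)
  rw [mul_left_comm c, ← lintegral_const_mul c h]
  congr 1
  refine lintegral_congr fun u => ?_
  have h' : Measurable fun y => ENNReal.ofReal (mehlerKernel m u x y) * F y :=
    (measurable_mehlerKernel_right m u x).ennreal_ofReal.mul hF
  rw [mul_left_comm c, ← lintegral_const_mul c h']
  simp only [mul_left_comm c]

theorem phi_pos (y : E d) : 0 < phi ν m y := by
  rw [phi_eq_mul_decay]
  exact mul_pos (Real.exp_pos _) (decay_pos _ _ (norm_nonneg y))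

theorem measurable_phi : Measurable fun y : E d => phi ν m y := by
  simp_rw [phi_eq_mul_decay]
  exact (by fun_prop : Measurable fun y : E d => Real.exp (-(‖y‖ ^ 2 / 2))).mul
    ((measurable_decay _ _).comp measurable_norm)

variable {ν m t}

/-- For small times and `y` far from `x`, the Mehler kernel is dominated by `φ`. -/
theorem mehlerKernel_le_phi_of_far (hν : 0 < ν) (hm : -(d : ℝ) ≤ m) {N : ℝ} (hN : 0 ≤ N) :
    ∃ C : ℝ, 0 < C ∧ ∀ u : ℝ, 0 < u → u ≤ 1 / 8 → ∀ x y : E d, ‖x‖ ≤ N → 4 * N + 4 ≤ ‖y‖ →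
      mehlerKernel m u x y ≤ C * phi ν m y := by
  obtain ⟨C₁, hC₁, h₁⟩ := rpow_le_mul_exp (b := (d : ℝ) / 2) (c := 1 / 8) (by positivity)
    (by norm_num)
  obtain ⟨C₂, hC₂, h₂⟩ := exp_neg_le_decay hν (neg_le_iff_add_nonneg'.1 hm) one_pos
  refine ⟨Real.exp |m| * C₁ * (Real.exp (4 + Real.exp 1) * C₂), by positivity,
    fun u hu hu8 x y hx hy => ?_⟩
  have hpow : u ^ (-((d : ℝ) / 2)) ≤ C₁ * Real.exp (1 / (8 * u)) := by
    have := h₁ u⁻¹ (by positivity)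
    rw [Real.inv_rpow hu.le, ← Real.rpow_neg hu.le] at this
    refine this.trans_eq ?_
    congr 2; field_simp
  have hd : 3 / 4 * ‖y‖ ≤ ‖x - y‖ := by
    have := norm_sub_norm_le y x
    rw [norm_sub_rev] at this
    linarith
  -- Half of the Gaussian exponent yields `e^{-1/(8u)}`, which absorbs `u^{-d/2}`. The other half is
  -- at least `‖x - y‖² ≥ (9/16)‖y‖²` because `u ≤ 1/8`; the surplus `‖y‖²/16 ≥ ‖y‖ - 4` over
  -- `‖y‖²/2` gives an extra exponential decay.
  have hexp : -(‖x - y‖ ^ 2 / (4 * u)) ≤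
      -(‖y‖ ^ 2 / 2) + (4 + Real.exp 1) + -(1 * (Real.exp 1 + ‖y‖)) - 1 / (8 * u) := by
    have h3 : ‖x - y‖ ^ 2 / (4 * u) = ‖x - y‖ ^ 2 * (1 / (8 * u)) + ‖x - y‖ ^ 2 * (1 / (8 * u)) := by
      field_simp; ring
    have h4 : 1 ≤ 1 / (8 * u) := by rw [le_div_iff₀ (by positivity)]; linarith
    have h5 : (3 / 4 * ‖y‖) ^ 2 ≤ ‖x - y‖ ^ 2 := by gcongr
    have h6 : 1 ≤ ‖x - y‖ ^ 2 := one_le_pow₀ (by linarith)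
    have h7 : ‖x - y‖ ^ 2 * 1 ≤ ‖x - y‖ ^ 2 * (1 / (8 * u)) := by gcongr
    have h8 : 1 * (1 / (8 * u)) ≤ ‖x - y‖ ^ 2 * (1 / (8 * u)) := by gcongr
    nlinarith [sq_nonneg (‖y‖ - 8)]
  rw [phi_eq_mul_decay]
  calc mehlerKernel m u x y
      ≤ Real.exp |m| * (u ^ (-((d : ℝ) / 2)) * Real.exp (-(‖x - y‖ ^ 2 / (4 * u)))) :=
        mehlerKernel_le_gaussian m hu (by linarith) x y
    _ ≤ Real.exp |m| * (C₁ * Real.exp (1 / (8 * u)) * Real.exp (-(‖y‖ ^ 2 / 2) +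
        (4 + Real.exp 1) + -(1 * (Real.exp 1 + ‖y‖)) - 1 / (8 * u))) := by gcongr
    _ = Real.exp |m| * C₁ * (Real.exp (-(‖y‖ ^ 2 / 2)) * Real.exp (4 + Real.exp 1) *
        Real.exp (-(1 * (Real.exp 1 + ‖y‖)))) := by
        rw [Real.exp_sub, Real.exp_add, Real.exp_add]
        field_simp
    _ ≤ Real.exp |m| * C₁ * (Real.exp (-(‖y‖ ^ 2 / 2)) * Real.exp (4 + Real.exp 1) *
        (C₂ * decay ν (d + m) ‖y‖)) := by gcongr; exact h₂ _ (norm_nonneg y)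
    _ = _ := by ring

/-- The mass is in fact `1`, by the substitution `t²/(4u)`, but only uniformity in `t` matters.
Splitting at `u = t²`, each piece scales as `(t²)^{-ν}`. -/
theorem poissonWeight_mass_le (hν : 0 < ν) :
    ∃ A : ℝ≥0, ∀ t : ℝ, 0 < t → ENNReal.ofReal (t ^ (2 * ν) / (4 ^ ν * Real.Gamma ν)) *
      ∫⁻ u in Ioi (0 : ℝ), ENNReal.ofReal (Real.exp (-(t ^ 2 / (4 * u))) / u ^ (1 + ν)) ≤ A := by
  obtain ⟨C, hC, h⟩ := rpow_le_mul_exp (b := 1 + ν) (c := 1 / 4) (by positivity) (by norm_num)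
  have hΓ := Real.Gamma_pos_of_pos hν
  refine ⟨((C + 1 / ν) / (4 ^ ν * Real.Gamma ν)).toNNReal, fun t ht => ?_⟩
  have ht2 : 0 < t ^ 2 := by positivity
  have h1 : ∫⁻ u in Ioc 0 (t ^ 2), ENNReal.ofReal (Real.exp (-(t ^ 2 / (4 * u))) / u ^ (1 + ν)) ≤
      ENNReal.ofReal (C * (t ^ 2) ^ (-ν)) := by
    calc _ ≤ ∫⁻ u in Ioc 0 (t ^ 2), ENNReal.ofReal (C * (t ^ 2) ^ (-(1 + ν))) := by
          refine setLIntegral_mono' measurableSet_Ioc fun u hu => ENNReal.ofReal_le_ofReal ?_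
          have hu0 : 0 < u := hu.1
          have h2 := h (t ^ 2 / u) (by positivity)
          rw [Real.div_rpow ht2.le hu0.le] at h2
          rw [Real.exp_neg, Real.rpow_neg ht2.le, ← div_eq_mul_inv, inv_eq_one_div, div_div,
            div_le_div_iff₀ (by positivity) (by positivity)]
          rw [div_le_iff₀ (by positivity)] at h2
          have h3 : 1 / 4 * (t ^ 2 / u) = t ^ 2 / (4 * u) := by field_simp
          rw [h3] at h2
          linarith
      _ = _ := by
          rw [setLIntegral_const, Real.volume_Ioc, sub_zero, ← ENNReal.ofReal_mul (by positivity),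
            mul_assoc, ← Real.rpow_add_one ht2.ne']
          congr 3; ring
  have h2 : ∫⁻ u in Ioi (t ^ 2), ENNReal.ofReal (Real.exp (-(t ^ 2 / (4 * u))) / u ^ (1 + ν)) ≤
      ENNReal.ofReal ((t ^ 2) ^ (-ν) / ν) := by
    rw [← lintegral_Ioi_rpow hν ht2]
    refine setLIntegral_mono' measurableSet_Ioi fun u hu => ENNReal.ofReal_le_ofReal ?_
    have hu0 : 0 < u := ht2.trans hu
    rw [Real.rpow_neg hu0.le, div_eq_mul_inv]
    refine mul_le_of_le_one_left (by positivity) (Real.exp_le_one_iff.2 ?_)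
    exact neg_nonpos.2 (by positivity)
  rw [← Ioc_union_Ioi_eq_Ioi ht2.le]
  calc _ ≤ ENNReal.ofReal (t ^ (2 * ν) / (4 ^ ν * Real.Gamma ν)) *
        (ENNReal.ofReal (C * (t ^ 2) ^ (-ν)) + ENNReal.ofReal ((t ^ 2) ^ (-ν) / ν)) := by
        gcongr
        exact (lintegral_union_le _ _ _).trans (add_le_add h1 h2)
    _ = ENNReal.ofReal ((C + 1 / ν) / (4 ^ ν * Real.Gamma ν)) := by
        rw [← ENNReal.ofReal_add (by positivity) (by positivity),
          ← ENNReal.ofReal_mul (by positivity)]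
        congr 1
        have : t ^ (2 * ν) * (t ^ 2) ^ (-ν) = 1 := by
          rw [Real.rpow_neg ht2.le, ← Real.rpow_natCast, ← Real.rpow_mul ht.le]
          push_cast
          exact mul_inv_cancel₀ (by positivity)
        calc _ = (t ^ (2 * ν) * (t ^ 2) ^ (-ν)) * ((C + 1 / ν) / (4 ^ ν * Real.Gamma ν)) := by ring
          _ = _ := by rw [this, one_mul]
    _ ≤ _ := le_rfl

/-- Tonelli for the part of `poissonE` over a set of times. -/
theorem lintegral_lintegral_poisson (S : Set ℝ) {F : (E d) → ℝ≥0∞} (hF : Measurable F) (x : E d) :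
    ∫⁻ u in S, ENNReal.ofReal (Real.exp (-(t ^ 2 / (4 * u))) / u ^ (1 + ν)) *
      ∫⁻ y, ENNReal.ofReal (mehlerKernel m u x y) * F y =
    ∫⁻ y, (∫⁻ u in S, ENNReal.ofReal (Real.exp (-(t ^ 2 / (4 * u))) / u ^ (1 + ν)) *
      ENNReal.ofReal (mehlerKernel m u x y)) * F y := by
  have hk := measurable_poissonWeight ν t
  have hmeas : Measurable fun z : ℝ × (E d) => ENNReal.ofReal (mehlerKernel m z.1 x z.2) :=
    ((measurable_mehlerKernel m).comp (f := fun z : ℝ × (E d) => (z.1, x, z.2))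
      (by fun_prop)).ennreal_ofReal
  calc _ = ∫⁻ u in S, ∫⁻ y, ENNReal.ofReal (Real.exp (-(t ^ 2 / (4 * u))) / u ^ (1 + ν)) *
        (ENNReal.ofReal (mehlerKernel m u x y) * F y) := by
        congr 1; ext u
        rw [lintegral_const_mul]
        exact (measurable_mehlerKernel_right m u x).ennreal_ofReal.mul hF
    _ = ∫⁻ y, ∫⁻ u in S, ENNReal.ofReal (Real.exp (-(t ^ 2 / (4 * u))) / u ^ (1 + ν)) *
        (ENNReal.ofReal (mehlerKernel m u x y) * F y) := by
        rw [lintegral_lintegral_swap]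
        exact ((hk.comp measurable_fst).mul
          (hmeas.mul (hF.comp measurable_snd))).aemeasurable
    _ = _ := by
        congr 1; ext y
        rw [← lintegral_mul_const]
        · simp only [mul_assoc]
        · exact hk.mul (hmeas.comp (f := fun u : ℝ => (u, y)) (by fun_prop))

/-- The part of the Poisson kernel coming from large times is dominated by `φ`. -/
theorem lintegral_large_poissonKernel_le (hν : 0 < ν) (hm : -(d : ℝ) ≤ m) {N : ℝ} (hN : 0 ≤ N) :
    ∃ C : ℝ≥0, ∀ t : ℝ, ∀ x y : E d, ‖x‖ ≤ N →
      ∫⁻ u in Ioi (1 / 8 : ℝ), ENNReal.ofReal (Real.exp (-(t ^ 2 / (4 * u))) / u ^ (1 + ν)) *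
        ENNReal.ofReal (mehlerKernel m u x y) ≤ C * ENNReal.ofReal (phi ν m y) := by
  obtain ⟨C₁, hC₁, h₁⟩ := mehlerKernel_le_of_large d m hN
  obtain ⟨C₂, h₂⟩ := lintegral_large_le hν (neg_le_iff_add_nonneg'.1 hm)
  refine ⟨C₁.toNNReal * C₂, fun t x y hx => ?_⟩
  calc _ ≤ ∫⁻ u in Ioi (1 / 8 : ℝ), ENNReal.ofReal (C₁ * Real.exp (-(‖y‖ ^ 2 / 2))) *
        ENNReal.ofReal (Real.exp (-((d + m) * u)) *
          Real.exp (-(Real.exp (-(4 * u)) * ‖y‖ ^ 2 / 8)) * u ^ (-(1 + ν))) := by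
        refine setLIntegral_mono' measurableSet_Ioi fun u hu => ?_
        have hu0 : 0 < u := lt_trans (by norm_num) hu
        rw [← ENNReal.ofReal_mul (by positivity), ← ENNReal.ofReal_mul (by positivity)]
        refine ENNReal.ofReal_le_ofReal ?_
        have h3 : Real.exp (-(t ^ 2 / (4 * u))) ≤ 1 :=
          Real.exp_le_one_iff.2 (neg_nonpos.2 (by positivity))
        calc _ ≤ 1 / u ^ (1 + ν) * (C₁ * (Real.exp (-(‖y‖ ^ 2 / 2)) *
              (Real.exp (-((d + m) * u)) * Real.exp (-(Real.exp (-(4 * u)) * ‖y‖ ^ 2 / 8))))) := by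
              refine mul_le_mul ?_ (h₁ u (le_of_lt hu) x y hx) (mehlerKernel_nonneg m hu0 x y)
                (by positivity)
              gcongr
          _ = _ := by rw [Real.rpow_neg hu0.le]; ring
    _ ≤ ENNReal.ofReal (C₁ * Real.exp (-(‖y‖ ^ 2 / 2))) *
        (C₂ * ENNReal.ofReal (decay ν (d + m) ‖y‖)) := by
        rw [lintegral_const_mul _ (by fun_prop)]
        gcongr
        exact h₂ _ (norm_nonneg y)
    _ = _ := by
        rw [phi_eq_mul_decay, ENNReal.ofReal_mul hC₁.le, ENNReal.ofReal_mul (Real.exp_pos _).le,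
          ENNReal.coe_mul]
        simp only [ENNReal.ofReal]
        ring

/-- The Poisson kernel is bounded below by `φ`. -/
theorem le_poissonE (hν : 0 < ν) (hm : -(d : ℝ) ≤ m) (ht : 0 < t) :
    ∃ c : ℝ, 0 < c ∧ ∀ F : (E d) → ℝ≥0∞, Measurable F → ∀ x : E d, ‖x‖ ≤ 1 →
      ENNReal.ofReal c * ∫⁻ y, F y * ENNReal.ofReal (phi ν m y) ≤ poissonE ν m t F x := by
  obtain ⟨c₁, hc₁, h₁⟩ := le_mehlerKernel d m
  obtain ⟨c₂, hc₂, h₂⟩ := le_lintegral_large hν (neg_le_iff_add_nonneg'.1 hm)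
  have hΓ := Real.Gamma_pos_of_pos hν
  refine ⟨t ^ (2 * ν) / (4 ^ ν * Real.Gamma ν) * (Real.exp (-(t ^ 2 / 2)) * c₁ * c₂),
    by positivity, fun F hF x hx => ?_⟩
  have hFphi : Measurable fun y => F y * ENNReal.ofReal (phi ν m y) :=
    hF.mul (measurable_phi ν m).ennreal_ofReal
  rw [poissonE, lintegral_lintegral_poisson _ hF, ENNReal.ofReal_mul (by positivity), mul_assoc,
    ← lintegral_const_mul _ hFphi]
  refine mul_le_mul_right (lintegral_mono fun y => ?_) _
  rw [mul_comm (F y), ← mul_assoc]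
  refine mul_le_mul_left ?_ _
  have hl := one_le_log_exp_add (norm_nonneg y)
  calc _ = ENNReal.ofReal (Real.exp (-(t ^ 2 / 2)) * c₁ * Real.exp (-(‖y‖ ^ 2 / 2))) *
        ENNReal.ofReal (c₂ * decay ν (d + m) ‖y‖) := by
        rw [← ENNReal.ofReal_mul (by positivity), ← ENNReal.ofReal_mul (by positivity),
          phi_eq_mul_decay]
        congr 1; ring
    _ ≤ ENNReal.ofReal (Real.exp (-(t ^ 2 / 2)) * c₁ * Real.exp (-(‖y‖ ^ 2 / 2))) *
        ∫⁻ u in Ioi (Real.log (Real.exp 1 + ‖y‖) / 2),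
        ENNReal.ofReal (Real.exp (-((d + m) * u)) * u ^ (-(1 + ν))) := by
        gcongr; exact h₂ _ (norm_nonneg y)
    _ = ∫⁻ u in Ioi (Real.log (Real.exp 1 + ‖y‖) / 2),
        ENNReal.ofReal (Real.exp (-(t ^ 2 / 2)) * c₁ * Real.exp (-(‖y‖ ^ 2 / 2))) *
        ENNReal.ofReal (Real.exp (-((d + m) * u)) * u ^ (-(1 + ν))) := by
        rw [lintegral_const_mul _ (by fun_prop)]
    _ ≤ ∫⁻ u in Ioi (Real.log (Real.exp 1 + ‖y‖) / 2),
        ENNReal.ofReal (Real.exp (-(t ^ 2 / (4 * u))) / u ^ (1 + ν)) *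
          ENNReal.ofReal (mehlerKernel m u x y) := by
        -- The range `u > log(e+‖y‖)/2` ensures both `u ≥ 1/2` and `‖y‖ ≤ e^{2u}`, the two
        -- conditions of the lower Mehler bound.
        refine setLIntegral_mono' measurableSet_Ioi fun u hu => ?_
        have hu' : Real.log (Real.exp 1 + ‖y‖) / 2 < u := hu
        have hu1 : 1 / 2 ≤ u := by linarith
        have hu0 : 0 < u := by linarith
        rw [← ENNReal.ofReal_mul (by positivity), ← ENNReal.ofReal_mul (by positivity)]
        refine ENNReal.ofReal_le_ofReal ?_
        have h3 : ‖y‖ ≤ Real.exp (2 * u) := by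
          have : Real.exp 1 + ‖y‖ ≤ Real.exp (2 * u) :=
            (Real.log_le_iff_le_exp (by positivity)).1 (by linarith)
          linarith [Real.exp_pos 1]
        have h4 : t ^ 2 / (4 * u) ≤ t ^ 2 / 2 := by
          gcongr; linarith
        calc _ = Real.exp (-(t ^ 2 / 2)) / u ^ (1 + ν) * (c₁ * (Real.exp (-(‖y‖ ^ 2 / 2)) *
              Real.exp (-((d + m) * u)))) := by rw [Real.rpow_neg hu0.le]; ring
          _ ≤ _ := by
              gcongr
              exact h₁ u hu1 x y hx h3
    _ ≤ _ := lintegral_mono_set (Ioi_subset_Ioi (by linarith))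

/-- Pointwise control of `poissonE` by the Hardy–Littlewood maximal function and `φ`. -/
theorem poissonE_le (hν : 0 < ν) (hm : -(d : ℝ) ≤ m) {a : ℝ} {N : ℝ} (hN : 0 ≤ N) :
    ∃ A : ℝ≥0, 0 < A ∧ ∀ t ∈ Ioo 0 a, ∀ F : (E d) → ℝ≥0∞, Measurable F → ∀ x : E d, ‖x‖ ≤ N →
      poissonE ν m t F x ≤
        A * (hardyLittlewood volume ((Metric.closedBall 0 (4 * N + 4)).indicator F) x +
          ∫⁻ y, F y * ENNReal.ofReal (phi ν m y)) := by
  obtain ⟨C₁, h₁⟩ := lintegral_gaussian_le_hardyLittlewood d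
  obtain ⟨C₂, hC₂, h₂⟩ := mehlerKernel_le_phi_of_far (d := d) hν hm hN
  obtain ⟨C₃, h₃⟩ := lintegral_large_poissonKernel_le hν hm hN
  obtain ⟨C₄, h₄⟩ := poissonWeight_mass_le hν
  have hΓ := Real.Gamma_pos_of_pos hν
  set B : ℝ≥0 := (Real.exp |m|).toNNReal * C₁ + C₂.toNNReal
  -- The summand `1` makes the constant positive, so that levels can later be divided by it.
  refine ⟨1 + (C₄ * B + (a ^ (2 * ν) / (4 ^ ν * Real.Gamma ν)).toNNReal * C₃), by positivity,
    fun t ht F hF x hx => ?_⟩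
  set G := (Metric.closedBall (0 : E d) (4 * N + 4)).indicator F with hG
  have hGm : Measurable G := hF.indicator Metric.isClosed_closedBall.measurableSet
  set M := hardyLittlewood volume G x
  set J := ∫⁻ y, F y * ENNReal.ofReal (phi ν m y) with hJ
  have hFphi : Measurable fun y => F y * ENNReal.ofReal (phi ν m y) :=
    hF.mul (measurable_phi ν m).ennreal_ofReal
  have hsmall : ∀ u ∈ Ioc (0 : ℝ) (1 / 8),
      ∫⁻ y, ENNReal.ofReal (mehlerKernel m u x y) * F y ≤ B * (M + J) := by
    intro u hu
    have hgm : Measurable fun y : E d => ENNReal.ofReal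
        (u ^ (-((d : ℝ) / 2)) * Real.exp (-(‖x - y‖ ^ 2 / (4 * u)))) * G y := by fun_prop
    calc _ ≤ ∫⁻ y, (ENNReal.ofReal (Real.exp |m|) * (ENNReal.ofReal (u ^ (-((d : ℝ) / 2)) *
          Real.exp (-(‖x - y‖ ^ 2 / (4 * u)))) * G y) +
          ENNReal.ofReal C₂ * (F y * ENNReal.ofReal (phi ν m y))) := by
          refine lintegral_mono fun y => ?_
          by_cases hy : y ∈ Metric.closedBall (0 : E d) (4 * N + 4)
          · refine le_trans ?_ le_self_add
            rw [hG, indicator_of_mem hy, ← mul_assoc, ← ENNReal.ofReal_mul (Real.exp_pos _).le]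
            gcongr
            exact mehlerKernel_le_gaussian m hu.1 (hu.2.trans (by norm_num)) x y
          · refine le_trans ?_ le_add_self
            rw [mul_comm (F y), ← mul_assoc, ← ENNReal.ofReal_mul hC₂.le]
            gcongr
            refine h₂ u hu.1 hu.2 x y hx ?_
            rw [mem_closedBall_zero_iff, not_le] at hy
            exact hy.le
      _ = ENNReal.ofReal (Real.exp |m|) * (∫⁻ y, ENNReal.ofReal (u ^ (-((d : ℝ) / 2)) *
          Real.exp (-(‖x - y‖ ^ 2 / (4 * u)))) * G y) + ENNReal.ofReal C₂ * J := by
          rw [lintegral_add_right _ (hFphi.const_mul _), lintegral_const_mul _ hFphi,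
            lintegral_const_mul _ hgm]
      _ ≤ ENNReal.ofReal (Real.exp |m|) * (C₁ * M) + ENNReal.ofReal C₂ * J := by
          gcongr; exact h₁ u hu.1 G hGm x
      _ ≤ ENNReal.ofReal (Real.exp |m|) * (C₁ * (M + J)) + ENNReal.ofReal C₂ * (M + J) := by
          gcongr
          · exact le_self_add
          · exact le_add_self
      _ = _ := by
          simp only [B, ENNReal.coe_add, ENNReal.coe_mul, ENNReal.ofReal]; ring
  rw [poissonE, ← Ioc_union_Ioi_eq_Ioi (by norm_num : (0 : ℝ) ≤ 1 / 8)]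
  set k := fun u : ℝ => ENNReal.ofReal (Real.exp (-(t ^ 2 / (4 * u))) / u ^ (1 + ν)) with hk
  set ct := ENNReal.ofReal (t ^ (2 * ν) / (4 ^ ν * Real.Gamma ν))
  have hkm : Measurable k := measurable_poissonWeight ν t
  have hS : ct * ∫⁻ u in Ioc (0 : ℝ) (1 / 8),
      k u * ∫⁻ y, ENNReal.ofReal (mehlerKernel m u x y) * F y ≤ C₄ * (B * (M + J)) := by
    calc _ ≤ ct * ∫⁻ u in Ioc (0 : ℝ) (1 / 8), k u * (B * (M + J)) := by
          gcongr 1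
          exact setLIntegral_mono' measurableSet_Ioc fun u hu => by gcongr; exact hsmall u hu
      _ ≤ ct * ∫⁻ u in Ioi (0 : ℝ), k u * (B * (M + J)) := by
          gcongr; exact Ioc_subset_Ioi_self
      _ ≤ _ := by
          rw [lintegral_mul_const _ hkm, ← mul_assoc]
          gcongr
          exact h₄ t ht.1
  have hL : ct * ∫⁻ u in Ioi (1 / 8 : ℝ),
      k u * ∫⁻ y, ENNReal.ofReal (mehlerKernel m u x y) * F y ≤
      (a ^ (2 * ν) / (4 ^ ν * Real.Gamma ν)).toNNReal * (C₃ * J) := by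
    rw [lintegral_lintegral_poisson _ hF]
    gcongr ?_ * ?_
    -- The bound `t < a` enters only here: it controls the factor `t^{2ν}` in front of the
    -- large-time part, which has no compensating decay in `t`.
    · have := ht.1
      exact ENNReal.ofReal_le_ofReal (by gcongr; exact ht.2.le)
    · rw [hJ, ← lintegral_const_mul _ hFphi]
      refine lintegral_mono fun y => ?_
      rw [mul_comm (F y), ← mul_assoc]
      gcongr
      exact h₃ t x y hx
  calc _ ≤ C₄ * (B * (M + J)) + (a ^ (2 * ν) / (4 ^ ν * Real.Gamma ν)).toNNReal * (C₃ * J) := by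
        refine (mul_le_mul_right (lintegral_union_le _ _ _) _).trans ?_
        rw [mul_add]
        exact add_le_add hS hL
    _ ≤ 1 * (M + J) + (C₄ * (B * (M + J)) +
        (a ^ (2 * ν) / (4 ^ ν * Real.Gamma ν)).toNNReal * (C₃ * (M + J))) := by
        refine le_trans ?_ le_add_self
        gcongr
        exact le_add_self
    _ = _ := by push_cast; ring

end Operator

/-! ### Interpolation with a weighted `L^∞` endpoint -/

section Marcinkiewicz

/-- Layer-cake formula. The indicator form, valid also at `∞`, is suited to Tonelli in both
directions. -/
theorem rpow_eq_lintegral_indicator {q : ℝ} (hq : 0 < q) (X : ℝ≥0∞) :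
    X ^ q = ∫⁻ s in Ioi (0 : ℝ), {s : ℝ | ENNReal.ofReal s < X}.indicator
      (fun s => ENNReal.ofReal (q * s ^ (q - 1))) s := by
  have hmeas : ∀ X : ℝ≥0∞, MeasurableSet {s : ℝ | ENNReal.ofReal s < X} := fun X =>
    measurableSet_lt (by fun_prop) measurable_const
  have hfin : ∀ x : ℝ≥0, (x : ℝ≥0∞) ^ q = ∫⁻ s in Ioi (0 : ℝ),
      {s : ℝ | ENNReal.ofReal s < x}.indicator (fun s => ENNReal.ofReal (q * s ^ (q - 1))) s := by
    intro x
    have hset : {s : ℝ | ENNReal.ofReal s < x} ∩ Ioi 0 = Ioo 0 (x : ℝ) := by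
      ext s
      simp only [mem_inter_iff, mem_ofPred_eq, mem_Ioi, mem_Ioo]
      rw [and_comm]
      refine and_congr_right fun hs => ?_
      rw [← ENNReal.ofReal_coe_nnreal, ENNReal.ofReal_lt_ofReal_iff_of_nonneg hs.le]
    have hint : IntervalIntegrable (fun s : ℝ => q * s ^ (q - 1)) volume 0 x :=
      (intervalIntegral.intervalIntegrable_rpow' (by linarith)).const_mul q
    rw [setLIntegral_indicator (hmeas _), hset, setLIntegral_congr Ioo_ae_eq_Ioc,
      ← ofReal_integral_eq_lintegral_ofReal
        ((intervalIntegrable_iff_integrableOn_Ioc_of_le x.coe_nonneg).1 hint)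
        ((ae_restrict_mem measurableSet_Ioc).mono fun s hs =>
          mul_nonneg hq.le (Real.rpow_nonneg hs.1.le _)),
      ← intervalIntegral.integral_of_le x.coe_nonneg, intervalIntegral.integral_const_mul,
      integral_rpow (Or.inl (by linarith)), sub_add_cancel, Real.zero_rpow hq.ne', sub_zero,
      mul_div_cancel₀ _ hq.ne', ← ENNReal.ofReal_rpow_of_nonneg x.coe_nonneg hq.le]
    simp
  induction X with
  | coe x => exact hfin x
  | top =>
    rw [ENNReal.top_rpow_of_pos hq]
    refine (ENNReal.eq_top_of_forall_nnreal_le fun r => ?_).symm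
    have h := hfin (r ^ q⁻¹)
    rw [← ENNReal.coe_rpow_of_nonneg _ hq.le, ← NNReal.rpow_mul, inv_mul_cancel₀ hq.ne',
      NNReal.rpow_one] at h
    rw [h]
    refine lintegral_mono fun s => indicator_le_indicator_of_subset (fun s hs => ?_)
      (fun _ => zero_le) s
    exact ENNReal.ofReal_lt_top

/-- An operator on nonnegative functions that is monotone, subadditive, homogeneous and of weak
type `(1, 1)` is, after division by its value at a fixed function `ψ`, bounded on `L^p`. -/
theorem lintegral_div_rpow_le_of_weak_type {α β : Type*} [MeasurableSpace α] [MeasurableSpace β]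
    (μ : Measure α) [SFinite μ] (μ₀ : Measure β) [SFinite μ₀]
    (T : (α → ℝ≥0∞) → β → ℝ≥0∞) (hTm : ∀ F, Measurable F → Measurable (T F))
    (hmono : ∀ F G : α → ℝ≥0∞, F ≤ G → T F ≤ T G)
    (hadd : ∀ F G : α → ℝ≥0∞, Measurable F → T (F + G) ≤ T F + T G)
    (hmul : ∀ (F : α → ℝ≥0∞) (c : ℝ≥0∞), Measurable F → T (fun y => c * F y) ≤ fun x => c * T F x)
    {Φ ψ : α → ℝ≥0∞} (hΦ : Measurable Φ) (hψ : Measurable ψ) (hψ0 : ∀ y, ψ y ≠ 0)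
    (hψt : ∀ y, ψ y ≠ ∞) {A : ℝ≥0}
    (hweak : ∀ F, Measurable F → ∀ l : ℝ≥0∞, l ≠ 0 → l ≠ ∞ →
      l * μ₀ {x | l < T F x} ≤ A * ∫⁻ y, F y * Φ y ∂μ)
    {p : ℝ} (hp : 1 < p) {F : α → ℝ≥0∞} (hF : Measurable F) :
    ∫⁻ x, (T F x / (1 + T ψ x)) ^ p ∂μ₀ ≤
      ENNReal.ofReal (2 * p / (p - 1)) * A *
        ∫⁻ y, F y * Φ y * (2 * F y / ψ y) ^ (p - 1) ∂μ := by
  set Y : β → ℝ≥0∞ := fun x => T F x / (1 + T ψ x)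
  have hY : Measurable Y := (hTm F hF).div (measurable_const.add (hTm ψ hψ))
  set D : ℝ → Set α := fun s => {y | ENNReal.ofReal s < 2 * F y / ψ y}
  have hDm : ∀ s, MeasurableSet (D s) := fun s => measurableSet_lt measurable_const (by fun_prop)
  have hDm' : MeasurableSet {z : ℝ × α | ENNReal.ofReal z.1 < 2 * F z.2 / ψ z.2} :=
    measurableSet_lt (by fun_prop) (by fun_prop)
  have hlevel : ∀ s : ℝ, 0 < s → ENNReal.ofReal (s / 2) * μ₀ {x | ENNReal.ofReal s < Y x} ≤
      A * ∫⁻ y, (D s).indicator (fun y => F y * Φ y) y ∂μ := by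
    intro s hs
    -- Cut `F` at the height `(s/2)ψ`. The low part contributes at most `(s/2)Tψ`, so `TF > s(1 +
    -- Tψ)` forces `TF₁ > s/2`. The `1` in the denominator makes room for the level `s/2`.
    set F₁ := (D s).indicator F
    have hl2 : ENNReal.ofReal s = ENNReal.ofReal (s / 2) + ENNReal.ofReal (s / 2) := by
      rw [← ENNReal.ofReal_add (by positivity) (by positivity), add_halves]
    have hF₁ : Measurable F₁ := hF.indicator (hDm s)
    have hle : F ≤ F₁ + fun y => ENNReal.ofReal (s / 2) * ψ y := by
      intro y
      by_cases hy : y ∈ D s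
      · simp only [F₁, Pi.add_apply, indicator_of_mem hy]
        exact le_self_add
      · simp only [F₁, Pi.add_apply, indicator_of_notMem hy, zero_add]
        have hy' : 2 * F y / ψ y ≤ ENNReal.ofReal s := not_lt.1 hy
        rw [ENNReal.div_le_iff (hψ0 y) (hψt y), hl2, add_mul, ← two_mul] at hy'
        exact (ENNReal.mul_le_mul_iff_right two_ne_zero ENNReal.ofNat_ne_top).1 hy'
    have hsub : {x | ENNReal.ofReal s < Y x} ⊆ {x | ENNReal.ofReal (s / 2) < T F₁ x} := by
      intro x hx
      rw [mem_ofPred_eq] at hx ⊢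
      by_contra hcon
      rw [not_lt] at hcon
      have h1 := ENNReal.mul_lt_of_lt_div hx
      have h2 : T F x ≤ ENNReal.ofReal s * (1 + T ψ x) := by
        calc T F x ≤ T F₁ x + ENNReal.ofReal (s / 2) * T ψ x :=
              (hmono _ _ hle x).trans ((hadd _ _ hF₁ x).trans
                (add_le_add le_rfl (hmul ψ _ hψ x)))
          _ ≤ ENNReal.ofReal s + ENNReal.ofReal s * T ψ x := by
              gcongr
              · exact hcon.trans (ENNReal.ofReal_le_ofReal (by linarith))
              · linarith
          _ = _ := by ring
      exact absurd h1 (not_lt.2 h2)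
    calc _ ≤ ENNReal.ofReal (s / 2) * μ₀ {x | ENNReal.ofReal (s / 2) < T F₁ x} := by
          gcongr
      _ ≤ A * ∫⁻ y, F₁ y * Φ y ∂μ := hweak F₁ hF₁ _ (by simpa using hs) ENNReal.ofReal_ne_top
      _ = _ := by
          congr 2; ext y
          by_cases hy : y ∈ D s
          · simp only [F₁, indicator_of_mem hy]
          · simp only [F₁, indicator_of_notMem hy, zero_mul]
  have hp0 : 0 < p := by linarith
  have hp1 : 0 < p - 1 := by linarith
  calc ∫⁻ x, Y x ^ p ∂μ₀
      = ∫⁻ x, (∫⁻ s in Ioi (0 : ℝ), {s : ℝ | ENNReal.ofReal s < Y x}.indicator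
          (fun s => ENNReal.ofReal (p * s ^ (p - 1))) s) ∂μ₀ := by
        simp_rw [← rpow_eq_lintegral_indicator hp0]
    _ = ∫⁻ s in Ioi (0 : ℝ), ∫⁻ x, {s : ℝ | ENNReal.ofReal s < Y x}.indicator
          (fun s => ENNReal.ofReal (p * s ^ (p - 1))) s ∂μ₀ := by
        rw [lintegral_lintegral_swap]
        have h1 : MeasurableSet {z : β × ℝ | ENNReal.ofReal z.2 < Y z.1} :=
          measurableSet_lt (by fun_prop) (by fun_prop)
        have h2 : Measurable fun z : β × ℝ => ENNReal.ofReal (p * z.2 ^ (p - 1)) := by fun_prop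
        exact (h2.indicator h1).aemeasurable
    -- One factor `s/2` of `p s^{p-1}` is spent on the weak type bound. What remains is normalised
    -- as `(p-1)s^{p-2}`, the layer-cake density of exponent `p - 1`.
    _ ≤ ∫⁻ s in Ioi (0 : ℝ), ENNReal.ofReal (2 * p / (p - 1) * ((p - 1) * s ^ (p - 1 - 1))) *
          (A * ∫⁻ y, (D s).indicator (fun y => F y * Φ y) y ∂μ) := by
        refine setLIntegral_mono' measurableSet_Ioi fun s hs => ?_
        have hs0 : 0 < s := hs
        calc _ = ENNReal.ofReal (p * s ^ (p - 1)) * μ₀ {x | ENNReal.ofReal s < Y x} := by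
              rw [← lintegral_indicator_const (measurableSet_lt measurable_const hY)]
              rfl
          _ = ENNReal.ofReal (2 * p / (p - 1) * ((p - 1) * s ^ (p - 1 - 1))) *
              (ENNReal.ofReal (s / 2) * μ₀ {x | ENNReal.ofReal s < Y x}) := by
              rw [← mul_assoc, ← ENNReal.ofReal_mul (by positivity)]
              congr 2
              rw [Real.rpow_sub_one hs0.ne' (p - 1)]
              field_simp
          _ ≤ _ := mul_le_mul_right (hlevel s hs0) _
    _ = ENNReal.ofReal (2 * p / (p - 1)) * A * ∫⁻ s in Ioi (0 : ℝ), ∫⁻ y,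
          ENNReal.ofReal ((p - 1) * s ^ (p - 1 - 1)) *
          (D s).indicator (fun y => F y * Φ y) y ∂μ := by
        rw [← lintegral_const_mul' _ _ (ENNReal.mul_ne_top ENNReal.ofReal_ne_top
          ENNReal.coe_ne_top)]
        refine lintegral_congr fun s => ?_
        rw [lintegral_const_mul' _ _ ENNReal.ofReal_ne_top, ENNReal.ofReal_mul (by positivity)]
        ring
    _ = ENNReal.ofReal (2 * p / (p - 1)) * A * ∫⁻ y, (∫⁻ s in Ioi (0 : ℝ),
          ENNReal.ofReal ((p - 1) * s ^ (p - 1 - 1)) *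
          (D s).indicator (fun y => F y * Φ y) y) ∂μ := by
        rw [lintegral_lintegral_swap]
        have h2 : Measurable fun z : ℝ × α => F z.2 * Φ z.2 := by fun_prop
        have h3 : Measurable fun z : ℝ × α => ENNReal.ofReal ((p - 1) * z.1 ^ (p - 1 - 1)) := by
          fun_prop
        exact (h3.mul (h2.indicator hDm')).aemeasurable
    _ = _ := by
        congr 1
        refine lintegral_congr fun y => ?_
        rw [rpow_eq_lintegral_indicator hp1, ← lintegral_const_mul _ (Measurable.indicator
          (by fun_prop) (measurableSet_lt (by fun_prop) measurable_const))]
        refine lintegral_congr fun s => ?_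
        by_cases h : ENNReal.ofReal s < 2 * F y / ψ y
        · rw [indicator_of_mem (show y ∈ D s from h),
            indicator_of_mem (show s ∈ {s : ℝ | ENNReal.ofReal s < 2 * F y / ψ y} from h), mul_comm]
        · rw [indicator_of_notMem (show y ∉ D s from h),
            indicator_of_notMem (show s ∉ {s : ℝ | ENNReal.ofReal s < 2 * F y / ψ y} from h)]
          simp

end Marcinkiewicz

/-! ### Weak type of the positive maximal operator -/

section Maximal

variable {d : ℕ}

local notation "E" d => EuclideanSpace ℝ (Fin d)

/-- The maximal operator of `poissonE` over the rational parameters in `(0, a)`. -/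
def maximalE (ν m a : ℝ) (F : (E d) → ℝ≥0∞) (x : E d) : ℝ≥0∞ :=
  ⨆ q : ℚ, ⨆ _ : (q : ℝ) ∈ Ioo 0 a, poissonE ν m q F x

variable (ν m a : ℝ)

theorem measurable_maximalE {F : (E d) → ℝ≥0∞} (hF : Measurable F) :
    Measurable (maximalE ν m a F) :=
  Measurable.iSup fun _ => Measurable.iSup fun _ => measurable_poissonE ν m _ hF

theorem maximalE_mono {F G : (E d) → ℝ≥0∞} (h : F ≤ G) : maximalE ν m a F ≤ maximalE ν m a G :=
  fun x => iSup₂_mono fun _ _ => poissonE_mono ν m _ h x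

theorem maximalE_add_le {F G : (E d) → ℝ≥0∞} (hF : Measurable F) :
    maximalE ν m a (F + G) ≤ maximalE ν m a F + maximalE ν m a G := by
  refine fun x => iSup₂_le fun q hq => ?_
  rw [poissonE_add ν m q hF x]
  exact add_le_add (le_iSup₂ (f := fun (q : ℚ) (_ : (q : ℝ) ∈ Ioo 0 a) => poissonE ν m q F x) q hq)
    (le_iSup₂ (f := fun (q : ℚ) (_ : (q : ℝ) ∈ Ioo 0 a) => poissonE ν m q G x) q hq)

theorem maximalE_const_mul_le {F : (E d) → ℝ≥0∞} (c : ℝ≥0∞) (hF : Measurable F) :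
    maximalE ν m a (fun y => c * F y) ≤ fun x => c * maximalE ν m a F x := by
  refine fun x => iSup₂_le fun q hq => ?_
  rw [poissonE_const_mul ν m q hF c x]
  exact mul_le_mul_right
    (le_iSup₂ (f := fun (q : ℚ) (_ : (q : ℝ) ∈ Ioo 0 a) => poissonE ν m q F x) q hq) c

variable {ν m a}

theorem exists_one_le_mul_phi (hν : 0 < ν) (hm : -(d : ℝ) ≤ m) (R : ℝ) :
    ∃ K : ℝ, 0 < K ∧ ∀ y : E d, ‖y‖ ≤ R → 1 ≤ K * phi ν m y := by
  obtain ⟨C, hC, h⟩ := exp_neg_le_decay hν (neg_le_iff_add_nonneg'.1 hm) one_pos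
  refine ⟨C * Real.exp (R ^ 2 / 2 + (Real.exp 1 + R)), by positivity, fun y hy => ?_⟩
  have h1 := h ‖y‖ (norm_nonneg y)
  have h2 : ‖y‖ ^ 2 ≤ R ^ 2 := pow_le_pow_left₀ (norm_nonneg y) hy 2
  rw [phi_eq_mul_decay]
  calc 1 = Real.exp 0 := Real.exp_zero.symm
    _ ≤ Real.exp (R ^ 2 / 2 + (Real.exp 1 + R) + -(‖y‖ ^ 2 / 2) + -(1 * (Real.exp 1 + ‖y‖))) := by
        gcongr; linarith
    _ = Real.exp (R ^ 2 / 2 + (Real.exp 1 + R)) * Real.exp (-(‖y‖ ^ 2 / 2)) *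
        Real.exp (-(1 * (Real.exp 1 + ‖y‖))) := by rw [Real.exp_add, Real.exp_add]
    _ ≤ Real.exp (R ^ 2 / 2 + (Real.exp 1 + R)) * Real.exp (-(‖y‖ ^ 2 / 2)) *
        (C * decay ν (d + m) ‖y‖) := by gcongr
    _ = _ := by ring

/-- In the pointwise bound the first term is of weak type (1,1), applied to `F` restricted to a
ball, where `φ` is bounded below. The second is a constant `J` in `x`: it exceeds `l'` nowhere, or
else `l' < J` and the volume of the ball suffices. Each term is compared with half the level, whence
`l' = l / (2A)`. -/
theorem maximalE_weak_type_closedBall (hd : 1 ≤ d) (hν : 0 < ν) (hm : -(d : ℝ) ≤ m) {N : ℝ}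
    (hN : 0 ≤ N) :
    ∃ A : ℝ≥0, ∀ F : (E d) → ℝ≥0∞, Measurable F → ∀ l : ℝ≥0∞, l ≠ 0 → l ≠ ∞ →
      l * volume (Metric.closedBall (0 : E d) N ∩ {x | l < maximalE ν m a F x}) ≤
        A * ∫⁻ y, F y * ENNReal.ofReal (phi ν m y) := by
  have : Nontrivial (E d) := by
    have : Nonempty (Fin d) := ⟨⟨0, hd⟩⟩
    infer_instance
  obtain ⟨A, hA, h⟩ := poissonE_le (d := d) (a := a) hν hm hN
  obtain ⟨K, hK, hKφ⟩ := exists_one_le_mul_phi (d := d) hν hm (4 * N + 4)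
  set V := volume (Metric.closedBall (0 : E d) N)
  have hV : V ≠ ∞ := measure_closedBall_lt_top.ne
  refine ⟨2 * A * (4 ^ d * K.toNNReal + V.toNNReal), fun F hF l hl hlt => ?_⟩
  set G := (Metric.closedBall (0 : E d) (4 * N + 4)).indicator F with hG
  set J := ∫⁻ y, F y * ENNReal.ofReal (phi ν m y)
  have hA0 : (2 * A : ℝ≥0∞) ≠ 0 := by
    simpa using hA.ne'
  have hAt : (2 * A : ℝ≥0∞) ≠ ∞ := ENNReal.mul_ne_top ENNReal.ofNat_ne_top ENNReal.coe_ne_top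
  set l' := l / (2 * A) with hl'
  have hll' : l = 2 * A * l' := (ENNReal.mul_div_cancel hA0 hAt).symm
  have hl'0 : l' ≠ 0 := ENNReal.div_ne_zero.2 ⟨hl, hAt⟩
  have hl't : l' ≠ ∞ := ENNReal.div_ne_top hlt hA0
  have hGJ : ∫⁻ y, G y ≤ K.toNNReal * J := by
    rw [← lintegral_const_mul' _ _ ENNReal.coe_ne_top]
    refine lintegral_mono fun y => ?_
    by_cases hy : y ∈ Metric.closedBall (0 : E d) (4 * N + 4)
    · rw [hG, indicator_of_mem hy, mul_left_comm]
      refine le_mul_of_one_le_right zero_le ?_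
      change 1 ≤ ENNReal.ofReal K * _
      rw [← ENNReal.ofReal_mul hK.le, ENNReal.one_le_ofReal]
      exact hKφ y (mem_closedBall_zero_iff.1 hy)
    · rw [hG, indicator_of_notMem hy]; exact zero_le
  have hpt : ∀ x ∈ Metric.closedBall (0 : E d) N, l < maximalE ν m a F x →
      l' < hardyLittlewood volume G x ∨ l' < J := by
    intro x hx hlx
    by_contra! hcon
    refine absurd hlx (not_lt.2 (iSup₂_le fun q hq => ?_))
    calc _ ≤ A * (hardyLittlewood volume G x + J) := h q hq F hF x (mem_closedBall_zero_iff.1 hx)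
      _ ≤ A * (l' + l') := by gcongr; exacts [hcon.1, hcon.2]
      _ = l := by rw [hll']; ring
  have hHL : l' * volume {x | l' < hardyLittlewood volume G x} ≤ 4 ^ d * (K.toNNReal * J) := by
    refine (mul_measure_lt_hardyLittlewood_le volume G hl'0 hl't).trans ?_
    rw [finrank_euclideanSpace_fin]
    gcongr
    rw [ENNReal.ofReal_pow (by norm_num)]
    simp
  have hmain : l' * volume (Metric.closedBall (0 : E d) N ∩ {x | l < maximalE ν m a F x}) ≤
      4 ^ d * (K.toNNReal * J) + V * J := by
    by_cases hJ : l' < J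
    · refine le_trans ?_ le_add_self
      rw [mul_comm V]
      exact mul_le_mul' hJ.le (measure_mono inter_subset_left)
    · refine le_trans ?_ (hHL.trans le_self_add)
      gcongr
      intro x hx
      exact (hpt x hx.1 hx.2).resolve_right hJ
  calc _ = 2 * A *
        (l' * volume (Metric.closedBall (0 : E d) N ∩ {x | l < maximalE ν m a F x})) := by
        rw [← mul_assoc, ← hll']
    _ ≤ 2 * A * (4 ^ d * (K.toNNReal * J) + V * J) := by gcongr
    _ = _ := by
        push_cast
        rw [ENNReal.coe_toNNReal hV]
        ring

/-- `maximalE` maps `L^1(φ)` to weak `L^1` for a suitable positive weight. -/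
theorem exists_weight_maximalE_weak_type (hd : 1 ≤ d) (hν : 0 < ν) (hm : -(d : ℝ) ≤ m) (a : ℝ) :
    ∃ V : (E d) → ℝ≥0∞, Measurable V ∧ (∀ x, V x ≠ 0) ∧ (∀ x, V x ≠ ∞) ∧ ∃ A : ℝ≥0,
      ∀ F : (E d) → ℝ≥0∞, Measurable F → ∀ l : ℝ≥0∞, l ≠ 0 → l ≠ ∞ →
        l * volume.withDensity V {x | l < maximalE ν m a F x} ≤
          A * ∫⁻ y, F y * ENNReal.ofReal (phi ν m y) := by
  choose A hA using fun N : ℕ =>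
    maximalE_weak_type_closedBall (d := d) (a := a) hd hν hm (Nat.cast_nonneg (α := ℝ) N)
  -- The coefficient offsets the uncontrolled growth of `A N` and leaves `2^{-N}`, whose sum is the
  -- final constant `2`.
  set b : ℕ → ℝ≥0∞ := fun N => 2⁻¹ ^ N * (1 + (A N : ℝ≥0∞))⁻¹
  have h1A : ∀ N, (1 + (A N : ℝ≥0∞)) ≠ 0 := fun N => by simp
  have h1A' : ∀ N, (1 + (A N : ℝ≥0∞)) ≠ ∞ := fun N => by simp
  have hb0 : ∀ N, b N ≠ 0 := fun N =>
    mul_ne_zero (pow_ne_zero _ (by simp)) (ENNReal.inv_ne_zero.2 (h1A' N))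
  have hb1 : ∀ N, b N ≤ 2⁻¹ ^ N := fun N =>
    mul_le_of_le_one_right zero_le (ENNReal.inv_le_one.2 le_self_add)
  have hbA : ∀ N, b N * A N ≤ 2⁻¹ ^ N := fun N => by
    rw [mul_assoc]
    refine mul_le_of_le_one_right zero_le ?_
    rw [mul_comm, ← div_eq_mul_inv]
    exact ENNReal.div_le_of_le_mul (by rw [one_mul]; exact le_add_self)
  set V : (E d) → ℝ≥0∞ := fun x => ∑' N : ℕ,
    (Metric.closedBall (0 : E d) N).indicator (fun _ => b N) x with hV
  have hball : ∀ N : ℕ, MeasurableSet (Metric.closedBall (0 : E d) N) := fun N =>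
    Metric.isClosed_closedBall.measurableSet
  have hm' : ∀ N : ℕ, Measurable ((Metric.closedBall (0 : E d) N).indicator (fun _ => b N)) :=
    fun N => measurable_const.indicator (hball N)
  refine ⟨V, Measurable.tsum hm', fun x => ?_, fun x => ?_, 2, fun F hF l hl hlt => ?_⟩
  · have hx : x ∈ Metric.closedBall (0 : E d) ⌈‖x‖⌉₊ := mem_closedBall_zero_iff.2 (Nat.le_ceil _)
    refine ((pos_iff_ne_zero.2 (hb0 ⌈‖x‖⌉₊)).trans_le ?_).ne'
    refine le_trans ?_ (ENNReal.le_tsum ⌈‖x‖⌉₊)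
    rw [indicator_of_mem hx]
  · refine ((ENNReal.tsum_le_tsum fun N => ?_).trans_lt
      (show ∑' N : ℕ, (2⁻¹ : ℝ≥0∞) ^ N < ∞ by rw [ENNReal.tsum_geometric_two]; simp)).ne
    exact (indicator_le_self _ _ x).trans (hb1 N)
  · set S := {x | l < maximalE ν m a F x}
    have hS : MeasurableSet S :=
      measurableSet_lt measurable_const (measurable_maximalE ν m a hF)
    calc l * volume.withDensity V S
        = ∑' N : ℕ, b N * (l * volume (Metric.closedBall (0 : E d) N ∩ S)) := by
          rw [withDensity_apply _ hS, hV, lintegral_tsum fun N => (hm' N).aemeasurable,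
            ← ENNReal.tsum_mul_left]
          refine tsum_congr fun N => ?_
          rw [lintegral_indicator_const (hball N), Measure.restrict_apply (hball N)]
          ring
      _ ≤ ∑' N : ℕ, 2⁻¹ ^ N * ∫⁻ y, F y * ENNReal.ofReal (phi ν m y) := by
          refine ENNReal.tsum_le_tsum fun N => ?_
          calc _ ≤ b N * (A N * ∫⁻ y, F y * ENNReal.ofReal (phi ν m y)) := by
                exact mul_le_mul_right (hA N F hF l hl hlt) _
            _ ≤ _ := by rw [← mul_assoc]; gcongr; exact hbA N
      _ = _ := by rw [ENNReal.tsum_mul_right, ENNReal.tsum_geometric_two]; simp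

end Maximal

/-! ### From the positive operator to the complex Poisson integral -/

section Link

variable {d : ℕ}

local notation "E" d => EuclideanSpace ℝ (Fin d)

variable {ν m : ℝ}

theorem enorm_complex_ofReal {r : ℝ} (hr : 0 ≤ r) : ‖(r : ℂ)‖ₑ = ENNReal.ofReal r := by
  rw [← ofReal_norm, Complex.norm_real, Real.norm_of_nonneg hr]

theorem poissonFactor_pos (hν : 0 < ν) {t : ℝ} (ht : 0 < t) :
    0 < t ^ (2 * ν) / (4 ^ ν * Real.Gamma ν) := by
  have := Real.Gamma_pos_of_pos hν
  positivity

theorem enorm_heat_le {u : ℝ} (hu : 0 < u) (f : (E d) → ℂ) (x : E d) :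
    ‖heat m u f x‖ₑ ≤ ∫⁻ y, ENNReal.ofReal (mehlerKernel m u x y) * ‖f y‖ₑ := by
  refine (enorm_integral_le_lintegral_enorm _).trans_eq (lintegral_congr fun y => ?_)
  rw [enorm_mul, enorm_complex_ofReal (mehlerKernel_nonneg m hu x y)]

theorem enorm_poisson_le (hν : 0 < ν) {t : ℝ} (ht : 0 < t) (f : (E d) → ℂ) (x : E d) :
    ‖poisson ν m t f x‖ₑ ≤ poissonE ν m t (fun y => ‖f y‖ₑ) x := by
  rw [poisson, enorm_mul, enorm_complex_ofReal (poissonFactor_pos hν ht).le, poissonE]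
  refine mul_le_mul_right ((enorm_integral_le_lintegral_enorm _).trans ?_) _
  refine setLIntegral_mono' measurableSet_Ioi fun u hu => ?_
  have hu0 : 0 < u := hu
  rw [enorm_mul, enorm_complex_ofReal (by positivity)]
  exact mul_le_mul_right (enorm_heat_le hu0 f x) _

theorem measurable_poissonIntegrand {f : (E d) → ℂ} (hf : Measurable f) (t : ℝ) (x : E d) :
    Measurable fun q : ℝ × (E d) =>
      ((Real.exp (-(t ^ 2 / (4 * q.1))) / q.1 ^ (1 + ν) : ℝ) : ℂ) *
        ((mehlerKernel m q.1 x q.2 : ℂ) * f q.2) := by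
  have h : Measurable fun q : ℝ × (E d) => mehlerKernel m q.1 x q.2 :=
    (measurable_mehlerKernel m).comp (f := fun q : ℝ × (E d) => (q.1, x, q.2)) (by fun_prop)
  have h' : Measurable fun q : ℝ × (E d) => Real.exp (-(t ^ 2 / (4 * q.1))) / q.1 ^ (1 + ν) := by
    fun_prop
  exact (Complex.measurable_ofReal.comp h').mul
    ((Complex.measurable_ofReal.comp h).mul (hf.comp measurable_snd))

theorem lintegral_enorm_poissonIntegrand {f : (E d) → ℂ} (hf : Measurable f) (t : ℝ) (x : E d) :
    ∫⁻ q : ℝ × (E d), ‖((Real.exp (-(t ^ 2 / (4 * q.1))) / q.1 ^ (1 + ν) : ℝ) : ℂ) *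
        ((mehlerKernel m q.1 x q.2 : ℂ) * f q.2)‖ₑ ∂((volume.restrict (Ioi (0 : ℝ))).prod volume) =
    ∫⁻ u in Ioi (0 : ℝ), ENNReal.ofReal (Real.exp (-(t ^ 2 / (4 * u))) / u ^ (1 + ν)) *
      ∫⁻ y, ENNReal.ofReal (mehlerKernel m u x y) * ‖f y‖ₑ := by
  rw [lintegral_prod _ (measurable_poissonIntegrand hf t x).enorm.aemeasurable]
  refine setLIntegral_congr_fun measurableSet_Ioi fun u hu => ?_
  have hu0 : 0 < u := hu
  have h : Measurable fun y => ENNReal.ofReal (mehlerKernel m u x y) * ‖f y‖ₑ :=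
    (measurable_mehlerKernel_right m u x).ennreal_ofReal.mul hf.enorm
  rw [← lintegral_const_mul _ h]
  refine lintegral_congr fun y => ?_
  rw [enorm_mul, enorm_mul, enorm_complex_ofReal (by positivity),
    enorm_complex_ofReal (mehlerKernel_nonneg m hu0 x y)]

theorem poissonConverges_iff (hν : 0 < ν) {t : ℝ} (ht : 0 < t) {f : (E d) → ℂ}
    (hf : Measurable f) (x : E d) :
    PoissonConverges ν m t f x ↔ poissonE ν m t (fun y => ‖f y‖ₑ) x < ∞ := by
  rw [PoissonConverges, Integrable, and_iff_right
    (measurable_poissonIntegrand hf t x).aestronglyMeasurable, HasFiniteIntegral,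
    lintegral_enorm_poissonIntegrand hf, poissonE]
  have hc : ENNReal.ofReal (t ^ (2 * ν) / (4 ^ ν * Real.Gamma ν)) ≠ 0 := by
    simpa using poissonFactor_pos hν ht
  refine ⟨fun h => ENNReal.mul_lt_top ENNReal.ofReal_lt_top h, fun h => ?_⟩
  exact ENNReal.lt_top_of_mul_ne_top_right h.ne hc

/-- The factor `e^{-t²/(4u)}` decreases in `t`. Convergence at arbitrarily small rational parameters
thus yields it at every parameter. -/
theorem poissonConverges_mono {s t : ℝ} (hs : 0 < s) (hst : s ≤ t) {f : (E d) → ℂ}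
    (hf : Measurable f) {x : E d} (h : PoissonConverges ν m s f x) :
    PoissonConverges ν m t f x := by
  have ht : 0 < t := hs.trans_le hst
  rw [PoissonConverges, Integrable, and_iff_right
    (measurable_poissonIntegrand hf _ x).aestronglyMeasurable, HasFiniteIntegral,
    lintegral_enorm_poissonIntegrand hf] at h ⊢
  refine lt_of_le_of_lt (setLIntegral_mono' measurableSet_Ioi fun u hu => ?_) h
  have hu0 : 0 < u := hu
  gcongr

/-- For nonnegative data there is no cancellation. Convergence is needed because a divergent Bochner
integral takes the default value `0`. -/
theorem enorm_poisson_ofReal (hν : 0 < ν) {t : ℝ} (ht : 0 < t) {g : (E d) → ℝ}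
    (hg : Measurable g) (hg0 : ∀ y, 0 ≤ g y) {x : E d}
    (h : PoissonConverges ν m t (fun y => (g y : ℂ)) x) :
    ‖poisson ν m t (fun y => (g y : ℂ)) x‖ₑ =
      poissonE ν m t (fun y => ENNReal.ofReal (g y)) x := by
  have hgc : Measurable fun y => (g y : ℂ) := Complex.measurable_ofReal.comp hg
  have hlin := lintegral_enorm_poissonIntegrand (ν := ν) (m := m) hgc t x
  have hnn : ∀ y, ‖(g y : ℂ)‖ₑ = ENNReal.ofReal (g y) := fun y => enorm_complex_ofReal (hg0 y)
  simp only [hnn] at hlin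
  set k : ℝ → ℝ := fun u => Real.exp (-(t ^ 2 / (4 * u))) / u ^ (1 + ν) with hk
  have h' : Integrable (fun q : ℝ × (E d) => k q.1 * (mehlerKernel m q.1 x q.2 * g q.2))
      ((volume.restrict (Ioi (0 : ℝ))).prod volume) := by
    refine h.re.congr (Filter.Eventually.of_forall fun q => ?_)
    simp only [RCLike.re_to_complex, ← Complex.ofReal_mul, Complex.ofReal_re, hk]
  have hpos : 0 ≤ᵐ[(volume.restrict (Ioi (0 : ℝ))).prod volume]
      fun q : ℝ × (E d) => k q.1 * (mehlerKernel m q.1 x q.2 * g q.2) := by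
    have : ∀ᵐ q ∂(volume.restrict (Ioi (0 : ℝ))).prod (volume : Measure (E d)), 0 < q.1 :=
      Measure.quasiMeasurePreserving_fst.ae (ae_restrict_mem measurableSet_Ioi)
    filter_upwards [this] with q hq
    have := mehlerKernel_nonneg m hq x q.2
    have := hg0 q.2
    simp only [hk, Pi.zero_apply]
    positivity
  have hint : ∫ u in Ioi (0 : ℝ), ((k u : ℝ) : ℂ) * heat m u (fun y => (g y : ℂ)) x =
      ((∫ u in Ioi (0 : ℝ), ∫ y, k u * (mehlerKernel m u x y * g y) : ℝ) : ℂ) := by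
    rw [← integral_complex_ofReal]
    refine integral_congr_ae (Filter.Eventually.of_forall fun u => ?_)
    simp only [heat]
    rw [← integral_complex_ofReal, ← integral_const_mul]
    simp only [Complex.ofReal_mul]
  rw [poisson, enorm_mul, enorm_complex_ofReal (poissonFactor_pos hν ht).le, poissonE, ← hlin, hint,
    ← integral_prod (fun q : ℝ × (E d) => k q.1 * (mehlerKernel m q.1 x q.2 * g q.2)) h',
    enorm_complex_ofReal (integral_nonneg_of_ae hpos),
    ofReal_integral_eq_lintegral_ofReal h' hpos]
  congr 1
  refine lintegral_congr_ae ?_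
  filter_upwards [hpos] with q hq
  rw [← Complex.ofReal_mul, ← Complex.ofReal_mul, enorm_complex_ofReal hq]

theorem measurable_heat {f : (E d) → ℂ} (hf : Measurable f) :
    Measurable fun z : ℝ × (E d) => heat m z.1 f z.2 := by
  have h : Measurable fun z : (ℝ × (E d)) × (E d) =>
      (mehlerKernel m z.1.1 z.1.2 z.2 : ℂ) * f z.2 :=
    (Complex.measurable_ofReal.comp ((measurable_mehlerKernel m).comp
      (g := fun z : ℝ × (E d) × (E d) => mehlerKernel m z.1 z.2.1 z.2.2)
      (f := fun z : (ℝ × (E d)) × (E d) => (z.1.1, z.1.2, z.2)) (by fun_prop))).mul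
      (hf.comp measurable_snd)
  exact h.stronglyMeasurable.integral_prod_right'.measurable

theorem measurable_poisson {f : (E d) → ℂ} (hf : Measurable f) (t : ℝ) :
    Measurable (poisson ν m t f) := by
  have h : Measurable fun z : (E d) × ℝ =>
      ((Real.exp (-(t ^ 2 / (4 * z.2))) / z.2 ^ (1 + ν) : ℝ) : ℂ) * heat m z.2 f z.1 :=
    (Complex.measurable_ofReal.comp (by fun_prop)).mul ((measurable_heat hf).comp measurable_swap)
  exact h.stronglyMeasurable.integral_prod_right'.measurable.const_mul _

/-- Dominated convergence: for `s > t/2` the integrand at `t/2` is a majorant. Continuity reduces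
the supremum over `t` to a countable one, which makes it measurable. -/
theorem continuousAt_poisson {f : (E d) → ℂ} (hf : Measurable f) {t : ℝ} (ht : 0 < t)
    {x : E d} (h : PoissonConverges ν m (t / 2) f x) :
    ContinuousAt (fun s => poisson ν m s f x) t := by
  have hheat : Measurable fun u => heat m u f x :=
    (measurable_heat hf).comp (f := fun u : ℝ => (u, x)) (by fun_prop)
  unfold poisson
  refine ContinuousAt.mul ?_ ?_
  · refine Complex.continuous_ofReal.continuousAt.comp ?_
    exact (Real.continuousAt_rpow_const _ _ (Or.inl ht.ne')).div_const _
  · refine continuousAt_of_dominated (bound := fun u =>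
      ‖((Real.exp (-((t / 2) ^ 2 / (4 * u))) / u ^ (1 + ν) : ℝ) : ℂ) * heat m u f x‖) ?_ ?_ ?_ ?_
    · refine Filter.Eventually.of_forall fun s => ?_
      exact ((Complex.measurable_ofReal.comp (by fun_prop)).mul hheat).aestronglyMeasurable
    · filter_upwards [Ioi_mem_nhds (half_lt_self ht)] with s hs
      filter_upwards [ae_restrict_mem measurableSet_Ioi] with u hu
      have hu0 : 0 < u := hu
      have hs' : t / 2 ≤ s := le_of_lt hs
      rw [norm_mul, norm_mul, Complex.norm_real, Complex.norm_real,
        Real.norm_of_nonneg (by positivity), Real.norm_of_nonneg (by positivity)]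
      gcongr
    · refine Integrable.norm ⟨((Complex.measurable_ofReal.comp
        (by fun_prop)).mul hheat).aestronglyMeasurable, ?_⟩
      have h2 := h.2
      rw [HasFiniteIntegral, lintegral_enorm_poissonIntegrand hf] at h2
      refine lt_of_le_of_lt (setLIntegral_mono' measurableSet_Ioi fun u hu => ?_) h2
      have hu0 : 0 < u := hu
      rw [enorm_mul, enorm_complex_ofReal (by positivity)]
      exact mul_le_mul_right (enorm_heat_le hu0 f x) _
    · filter_upwards [ae_restrict_mem measurableSet_Ioi] with u hu
      refine ContinuousAt.mul (Continuous.continuousAt ?_) continuousAt_const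
      fun_prop

theorem iSup_Ioo_eq_iSup_rat {a : ℝ} {g : ℝ → ℝ≥0∞} (hg : ∀ t ∈ Ioo 0 a, ContinuousAt g t) :
    ⨆ t ∈ Ioo (0 : ℝ) a, g t = ⨆ q : ℚ, ⨆ _ : (q : ℝ) ∈ Ioo 0 a, g q := by
  refine le_antisymm (iSup₂_le fun t ht => ?_) (iSup₂_le fun q hq =>
    le_iSup₂ (f := fun (t : ℝ) (_ : t ∈ Ioo (0 : ℝ) a) => g t) (q : ℝ) hq)
  by_contra! hcon
  have h1 := (hg t ht).eventually (lt_mem_nhds hcon)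
  have h2 := h1.and (Ioo_mem_nhds ht.1 ht.2)
  obtain ⟨l, u, hlu, hsub⟩ := mem_nhds_iff_exists_Ioo_subset.1 h2
  obtain ⟨q, hq1, hq2⟩ := exists_rat_btwn (hlu.1.trans hlu.2)
  have hq := hsub ⟨hq1, hq2⟩
  exact absurd hq.1 (not_lt.2 (le_iSup₂ (f := fun (q : ℚ) (_ : (q : ℝ) ∈ Ioo 0 a) => g q) q hq.2))

theorem poisson_congr_ae {f g : (E d) → ℂ} (h : f =ᵐ[volume] g) (t : ℝ) (x : E d) :
    poisson ν m t f x = poisson ν m t g x := by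
  have : ∀ u, heat m u f x = heat m u g x := fun u => by
    refine integral_congr_ae ?_
    filter_upwards [h] with y hy
    rw [hy]
  simp only [poisson, this]

theorem poissonConverges_congr_ae {f g : (E d) → ℂ} (h : f =ᵐ[volume] g) (t : ℝ) (x : E d) :
    PoissonConverges ν m t f x ↔ PoissonConverges ν m t g x := by
  refine integrable_congr ?_
  filter_upwards [Measure.quasiMeasurePreserving_snd.ae h] with q hq
  rw [hq]

/-- If the positive maximal function is finite almost everywhere, then the Poisson integrals
converge and the local maximal function is measurable and dominated by the positive one. -/
theorem localMaximal_of_maximalE_lt_top (hν : 0 < ν) {a : ℝ} {f : (E d) → ℂ} (hf : Measurable f)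
    (h : ∀ᵐ x, maximalE ν m a (fun y => ‖f y‖ₑ) x < ∞) :
    (∀ᵐ x, ∀ t ∈ Ioo (0 : ℝ) a, PoissonConverges ν m t f x) ∧
      AEMeasurable (localMaximal ν m a f) volume ∧
      ∀ᵐ x, localMaximal ν m a f x ≤ maximalE ν m a (fun y => ‖f y‖ₑ) x := by
  have hconv : ∀ᵐ x, ∀ t ∈ Ioo (0 : ℝ) a, PoissonConverges ν m t f x := by
    filter_upwards [h] with x hx t ht
    obtain ⟨q, hq0, hqt⟩ := exists_rat_btwn ht.1
    refine poissonConverges_mono hq0 hqt.le hf ((poissonConverges_iff hν hq0 hf x).2 ?_)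
    exact lt_of_le_of_lt (le_iSup₂ (f := fun (q : ℚ) (_ : (q : ℝ) ∈ Ioo 0 a) =>
      poissonE ν m q (fun y => ‖f y‖ₑ) x) q ⟨hq0, hqt.trans ht.2⟩) hx
  have hsup : ∀ᵐ x, localMaximal ν m a f x =
      ⨆ q : ℚ, ⨆ _ : (q : ℝ) ∈ Ioo 0 a, ‖poisson ν m q f x‖ₑ := by
    filter_upwards [hconv] with x hx
    refine iSup_Ioo_eq_iSup_rat (g := fun t => ‖poisson ν m t f x‖ₑ) fun t ht => ?_
    refine (continuousAt_poisson hf ht.1 (hx _ ⟨half_pos ht.1, ?_⟩)).enorm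
    linarith [ht.1, ht.2]
  have hm : Measurable fun x => ⨆ q : ℚ, ⨆ _ : (q : ℝ) ∈ Ioo 0 a, ‖poisson ν m q f x‖ₑ :=
    Measurable.iSup fun q => Measurable.iSup fun _ => (measurable_poisson hf q).enorm
  refine ⟨hconv, ⟨_, hm, hsup⟩, ?_⟩
  filter_upwards [hsup] with x hx
  rw [hx]
  exact iSup₂_mono fun q hq => enorm_poisson_le hν hq.1 f x

end Link

/-! ### Weights, the extremal function and the two implications -/

section Weights

variable {d : ℕ}

local notation "E" d => EuclideanSpace ℝ (Fin d)

/-- The value `1` on the exceptional set keeps `W` nonzero and finite everywhere, so that divisions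
by `W` need no almost-everywhere provisos. -/
theorem IsWeight.exists_measurable {w : (E d) → ℝ} (hw : IsWeight w) :
    ∃ W : (E d) → ℝ≥0∞, Measurable W ∧ (∀ x, W x ≠ 0) ∧ (∀ x, W x ≠ ∞) ∧
      ∀ᵐ x, 0 < w x ∧ ENNReal.ofReal (w x) = W x := by
  obtain ⟨w₀, hw₀, hww₀⟩ := hw.aemeasurable
  refine ⟨fun x => if 0 < w₀ x then ENNReal.ofReal (w₀ x) else 1,
    Measurable.ite (measurableSet_lt measurable_const hw₀) hw₀.ennreal_ofReal measurable_const,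
    fun x => ?_, fun x => ?_, ?_⟩
  · dsimp only
    split_ifs with h
    · simpa using h
    · exact one_ne_zero
  · dsimp only
    split_ifs with h
    · exact ENNReal.ofReal_ne_top
    · exact ENNReal.one_ne_top
  · filter_upwards [hw.pos, hww₀] with x hx hx'
    have : 0 < w₀ x := by rw [← hx']; exact hx
    rw [if_pos this, ← hx']
    exact ⟨hx, rfl⟩

theorem weightMeasure_eq {w : (E d) → ℝ} {W : (E d) → ℝ≥0∞}
    (h : ∀ᵐ x, ENNReal.ofReal (w x) = W x) : weightMeasure w = volume.withDensity W :=
  withDensity_congr_ae h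

theorem eLpNorm_withDensity_eq {ε : Type*} [TopologicalSpace ε] [ContinuousENorm ε]
    {W : (E d) → ℝ≥0∞} (hW : Measurable W) (hWt : ∀ x, W x ≠ ∞) {p : ℝ} (hp : 0 < p)
    (f : (E d) → ε) :
    eLpNorm f (ENNReal.ofReal p) (volume.withDensity W) =
      (∫⁻ x, ‖f x‖ₑ ^ p * W x) ^ (1 / p) := by
  rw [eLpNorm_eq_lintegral_rpow_enorm_toReal (by simpa using hp) ENNReal.ofReal_ne_top,
    ENNReal.toReal_ofReal hp.le, lintegral_withDensity_eq_lintegral_mul_non_measurable _ hW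
      (Filter.Eventually.of_forall fun x => (hWt x).lt_top)]
  simp only [Pi.mul_apply, mul_comm]

/-- The extremal function of the pairing of `L^p(w)` with `φ`. -/
def extremal (ν m p : ℝ) (W : (E d) → ℝ≥0∞) (y : E d) : ℝ≥0∞ :=
  (ENNReal.ofReal (phi ν m y) / W y) ^ (1 / (p - 1))

section Extremal

variable {ν m p : ℝ} {W : (E d) → ℝ≥0∞}

theorem ofReal_phi_ne_zero (ν m : ℝ) (y : E d) : ENNReal.ofReal (phi ν m y) ≠ 0 := by
  simpa using phi_pos ν m y

theorem phi_le_one (hν : 0 < ν) (m : ℝ) (y : E d) : phi ν m y ≤ 1 := by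
  have hl := one_le_log_exp_add (norm_nonneg y)
  have h : decay ν (d + m) ‖y‖ ≤ 1 := by
    unfold decay
    split_ifs with h
    · refine div_le_one_of_le₀ (one_le_mul_of_one_le_of_one_le ?_ ?_) (by positivity)
      · exact Real.one_le_rpow (by linarith [norm_nonneg y]) (by positivity)
      · exact Real.one_le_rpow hl (by positivity)
    · exact div_le_one_of_le₀ (Real.one_le_rpow hl hν.le) (by positivity)
  rw [phi_eq_mul_decay]
  refine mul_le_one₀ (Real.exp_le_one_iff.2 (neg_nonpos.2 (by positivity)))
    (decay_pos _ _ (norm_nonneg y)).le h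

theorem measurable_extremal (hW : Measurable W) : Measurable (extremal ν m p W) :=
  ((measurable_phi ν m).ennreal_ofReal.div hW).pow_const _

theorem extremal_ne_zero (hWt : ∀ x, W x ≠ ∞) (hp : 1 < p) (y : E d) :
    extremal ν m p W y ≠ 0 := by
  have : 0 < 1 / (p - 1) := one_div_pos.2 (by linarith)
  rw [extremal, Ne, ENNReal.rpow_eq_zero_iff_of_pos this]
  exact ENNReal.div_ne_zero.2 ⟨ofReal_phi_ne_zero ν m y, hWt y⟩

theorem extremal_ne_top (hW0 : ∀ x, W x ≠ 0) (hp : 1 < p) (y : E d) :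
    extremal ν m p W y ≠ ∞ :=
  ENNReal.rpow_ne_top_of_nonneg (one_div_nonneg.2 (by linarith))
    (ENNReal.div_ne_top ENNReal.ofReal_ne_top (hW0 y))

theorem extremal_rpow (hp : 1 < p) (y : E d) :
    extremal ν m p W y ^ (p - 1) = ENNReal.ofReal (phi ν m y) / W y := by
  rw [extremal, ← ENNReal.rpow_mul, one_div_mul_cancel (by linarith), ENNReal.rpow_one]

/-- Equality case of Hölder: on `ψ` the `L^p(w)` integral and the pairing with `φ` coincide, also
after truncation. -/
theorem extremal_rpow_mul (hW0 : ∀ x, W x ≠ 0) (hWt : ∀ x, W x ≠ ∞) (hp : 1 < p) (y : E d) :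
    extremal ν m p W y ^ p * W y = extremal ν m p W y * ENNReal.ofReal (phi ν m y) := by
  have h : extremal ν m p W y ^ p = extremal ν m p W y * extremal ν m p W y ^ (p - 1) := by
    nth_rw 2 [← ENNReal.rpow_one (extremal ν m p W y)]
    rw [← ENNReal.rpow_add_of_nonneg _ _ zero_le_one (by linarith), add_sub_cancel]
  rw [h, extremal_rpow hp, mul_assoc, ENNReal.div_mul_cancel (hW0 y) (hWt y)]

/-- Since `φ ψ^{-(p-1)} = W`, the right side of the interpolation inequality becomes the `L^p(w)`
integral. -/
theorem mul_div_extremal_rpow (hW0 : ∀ x, W x ≠ 0) (hWt : ∀ x, W x ≠ ∞) (hp : 1 < p)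
    (F : (E d) → ℝ≥0∞) (y : E d) :
    F y * ENNReal.ofReal (phi ν m y) * (2 * F y / extremal ν m p W y) ^ (p - 1) =
      2 ^ (p - 1) * (F y ^ p * W y) := by
  have hp1 : 0 ≤ p - 1 := by linarith
  have h : F y ^ p = F y * F y ^ (p - 1) := by
    conv_lhs => rw [show p = 1 + (p - 1) by ring]
    rw [ENNReal.rpow_add_of_nonneg _ _ zero_le_one hp1, ENNReal.rpow_one]
  have hΦ := ofReal_phi_ne_zero ν m y
  rw [ENNReal.div_rpow_of_nonneg _ _ hp1, extremal_rpow hp, ENNReal.mul_rpow_of_nonneg _ _ hp1, h,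
    div_eq_mul_inv, ENNReal.inv_div (Or.inl (hWt y)) (Or.inl (hW0 y))]
  calc _ = 2 ^ (p - 1) * (F y * F y ^ (p - 1) *
        (W y / ENNReal.ofReal (phi ν m y) * ENNReal.ofReal (phi ν m y))) := by ring
    _ = _ := by rw [ENNReal.div_mul_cancel hΦ ENNReal.ofReal_ne_top]

theorem eLpNorm_lt_top_iff_extremal (hp : 1 < p) {w : (E d) → ℝ}
    (h : ∀ᵐ x, 0 < w x ∧ ENNReal.ofReal (w x) = W x) :
    eLpNorm (fun x => w x ^ (-(1 / p)) * phi ν m x) (ENNReal.ofReal (p / (p - 1))) volume < ∞ ↔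
      ∫⁻ y, extremal ν m p W y * ENNReal.ofReal (phi ν m y) < ∞ := by
  have hp1 : 0 < p - 1 := by linarith
  have hp' : 0 < p / (p - 1) := by positivity
  rw [eLpNorm_lt_top_iff_lintegral_rpow_enorm_lt_top (by simpa using hp') ENNReal.ofReal_ne_top,
    ENNReal.toReal_ofReal hp'.le]
  refine Eq.to_iff (congrArg (· < ∞) (lintegral_congr_ae ?_))
  filter_upwards [h] with x hx
  have hφ := phi_pos ν m x
  have hw := hx.1
  rw [extremal, ← hx.2, Real.enorm_of_nonneg (by positivity), ← ENNReal.ofReal_div_of_pos hw,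
    ENNReal.ofReal_rpow_of_pos (by positivity), ENNReal.ofReal_rpow_of_pos (by positivity),
    ← ENNReal.ofReal_mul (by positivity)]
  congr 1
  rw [Real.mul_rpow (by positivity) hφ.le, ← Real.rpow_mul hw.le, Real.div_rpow hφ.le hw.le,
    show p / (p - 1) = 1 / (p - 1) + 1 by field_simp; ring, Real.rpow_add_one hφ.ne',
    show -(1 / p) * (1 / (p - 1) + 1) = -(1 / (p - 1)) by field_simp; ring,
    Real.rpow_neg hw.le]
  ring

end Extremal

/-- The set of infinite values lies in every superlevel set, so all multiples of its measure obey
one finite bound. As `V` vanishes nowhere, null sets for `V dx` are Lebesgue null. -/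
theorem maximalE_lt_top_of_weak_type {ν m a : ℝ} {V : (E d) → ℝ≥0∞} (hV : Measurable V)
    (hV0 : ∀ x, V x ≠ 0) {A : ℝ≥0}
    (hweak : ∀ F : (E d) → ℝ≥0∞, Measurable F → ∀ l : ℝ≥0∞, l ≠ 0 → l ≠ ∞ →
      l * volume.withDensity V {x | l < maximalE ν m a F x} ≤
        A * ∫⁻ y, F y * ENNReal.ofReal (phi ν m y))
    {F : (E d) → ℝ≥0∞} (hF : Measurable F)
    (hfin : ∫⁻ y, F y * ENNReal.ofReal (phi ν m y) < ∞) :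
    ∀ᵐ x, maximalE ν m a F x < ∞ := by
  have hac : (volume : Measure (E d)) ≪ volume.withDensity V :=
    withDensity_absolutelyContinuous' hV.aemeasurable (Filter.Eventually.of_forall hV0)
  refine hac.ae_le ?_
  change ∀ᵐ x ∂volume.withDensity V, maximalE ν m a F x < ∞
  rw [ae_iff]
  set S := {x | ¬ maximalE ν m a F x < ∞}
  have hS : ∀ n : ℕ, ((n : ℝ≥0∞) + 1) * volume.withDensity V S ≤
      A * ∫⁻ y, F y * ENNReal.ofReal (phi ν m y) := fun n => by
    have hn : ((n : ℝ≥0∞) + 1) ≠ ∞ := by simp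
    refine le_trans ?_ (hweak F hF (n + 1) (by simp) hn)
    refine mul_le_mul_right (measure_mono fun x hx => ?_) _
    have hx' : maximalE ν m a F x = ∞ := not_lt_top_iff.1 hx
    rw [mem_ofPred_eq, hx']
    exact hn.lt_top
  by_contra h0
  have hAfin : A * ∫⁻ y, F y * ENNReal.ofReal (phi ν m y) < ∞ :=
    ENNReal.mul_lt_top ENNReal.coe_lt_top hfin
  obtain ⟨n, hn⟩ := ENNReal.exists_nat_mul_gt h0 hAfin.ne
  refine absurd hn (not_lt.2 (le_trans ?_ (hS n)))
  gcongr
  exact le_self_add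

theorem exists_weight_maximalBounded (hd : 1 ≤ d) {m : ℝ} (hm : -(d : ℝ) ≤ m) {ν : ℝ} (hν : 0 < ν)
    {p : ℝ} (hp : 1 < p) (a : ℝ) {w : (E d) → ℝ} {W : (E d) → ℝ≥0∞} (hW : Measurable W)
    (hW0 : ∀ x, W x ≠ 0) (hWt : ∀ x, W x ≠ ∞) (hwW : ∀ᵐ x, ENNReal.ofReal (w x) = W x)
    (hfin : ∫⁻ y, extremal ν m p W y * ENNReal.ofReal (phi ν m y) < ∞) :
    ∃ v : (E d) → ℝ, IsWeight v ∧ MaximalBounded ν m a p w v := by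
  have hp0 : 0 < p := by linarith
  obtain ⟨V, hV, hV0, hVt, A, hweak⟩ := exists_weight_maximalE_weak_type (d := d) hd hν hm a
  set ψ := extremal ν m p W
  have hψ : Measurable ψ := measurable_extremal hW
  set B := maximalE ν m a ψ
  have hB : Measurable B := measurable_maximalE ν m a hψ
  have hBfin : ∀ᵐ x, B x < ∞ := maximalE_lt_top_of_weak_type hV hV0 hweak hψ hfin
  -- This is the weight `v`. It is positive almost everywhere exactly because `Tψ` is finite there,
  -- which is where `hfin` enters.
  set U : (E d) → ℝ≥0∞ := fun x => V x / (1 + B x) ^ p with hU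
  have hUm : Measurable U := hV.div ((measurable_const.add hB).pow_const p)
  have h1B : ∀ x, (1 + B x) ^ p ≠ 0 := fun x => by
    rw [Ne, ENNReal.rpow_eq_zero_iff_of_pos hp0]; simp
  have hUt : ∀ x, U x ≠ ∞ := fun x => ENNReal.div_ne_top (hVt x) (h1B x)
  have hU0 : ∀ᵐ x, U x ≠ 0 := by
    filter_upwards [hBfin] with x hx
    exact ENNReal.div_ne_zero.2 ⟨hV0 x, ENNReal.rpow_ne_top_of_nonneg hp0.le
      (ENNReal.add_ne_top.2 ⟨ENNReal.one_ne_top, hx.ne⟩)⟩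
  have hwac : (volume : Measure (E d)) ≪ volume.withDensity W :=
    withDensity_absolutelyContinuous' hW.aemeasurable (Filter.Eventually.of_forall hW0)
  set K : ℝ≥0∞ := ENNReal.ofReal (2 * p / (p - 1)) * A * 2 ^ (p - 1) with hK
  have hKt : K ≠ ∞ := ENNReal.mul_ne_top (ENNReal.mul_ne_top ENNReal.ofReal_ne_top
    ENNReal.coe_ne_top) (ENNReal.rpow_ne_top_of_nonneg (by linarith) ENNReal.ofNat_ne_top)
  have hbound : ∀ F : (E d) → ℝ≥0∞, Measurable F →
      ∫⁻ x, maximalE ν m a F x ^ p * U x ≤ K * ∫⁻ y, F y ^ p * W y := by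
    intro F hF
    have hTF := measurable_maximalE ν m a hF
    have h := lintegral_div_rpow_le_of_weak_type volume (volume.withDensity V) (maximalE ν m a)
      (fun F hF => measurable_maximalE ν m a hF) (fun F G h => maximalE_mono ν m a h)
      (fun F G hF => maximalE_add_le ν m a hF) (fun F c hF => maximalE_const_mul_le ν m a c hF)
      (measurable_phi ν m).ennreal_ofReal hψ (extremal_ne_zero hWt hp) (extremal_ne_top hW0 hp)
      hweak hp hF
    have hFW : Measurable fun y => F y ^ p * W y := (hF.pow_const p).mul hW
    have hY : Measurable fun x => (maximalE ν m a F x / (1 + maximalE ν m a ψ x)) ^ p :=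
      (hTF.div (measurable_const.add hB)).pow_const p
    rw [lintegral_withDensity_eq_lintegral_mul _ hV hY] at h
    simp only [ψ, mul_div_extremal_rpow hW0 hWt hp] at h
    rw [lintegral_const_mul _ hFW, ← mul_assoc] at h
    refine le_trans (le_of_eq (lintegral_congr fun x => ?_)) h
    simp only [Pi.mul_apply, hU]
    rw [ENNReal.div_rpow_of_nonneg _ _ hp0.le, div_eq_mul_inv, div_eq_mul_inv]
    ring
  refine ⟨fun x => (U x).toReal, ⟨hUm.ennreal_toReal.aemeasurable, ?_⟩, (K ^ (1 / p)).toNNReal,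
    fun f hf => ?_⟩
  · filter_upwards [hU0] with x hx
    exact ENNReal.toReal_pos hx (hUt x)
  have hmeasv : weightMeasure (fun x => (U x).toReal) = volume.withDensity U :=
    weightMeasure_eq (Filter.Eventually.of_forall fun x => ENNReal.ofReal_toReal (hUt x))
  rw [weightMeasure_eq hwW] at hf ⊢
  rw [hmeasv]
  -- As `W` vanishes nowhere, measurability modulo `W dx` transfers to Lebesgue measure. Then `f`
  -- may be replaced by a measurable representative, which changes no Poisson integral.
  have hfm : AEStronglyMeasurable f volume := hf.1.mono_ac hwac
  set g := hfm.aemeasurable.mk f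
  have hg : Measurable g := hfm.aemeasurable.measurable_mk
  have hfg : f =ᵐ[volume] g := hfm.aemeasurable.ae_eq_mk
  have hnorm := eLpNorm_withDensity_eq hW hWt hp0 f
  have hint : ∫⁻ x, ‖f x‖ₑ ^ p * W x = ∫⁻ x, ‖g x‖ₑ ^ p * W x := by
    refine lintegral_congr_ae ?_
    filter_upwards [hfg] with x hx
    rw [hx]
  have hlt : ∫⁻ x, ‖g x‖ₑ ^ p * W x < ∞ := by
    have h := hf.2
    rw [hnorm, hint, ENNReal.rpow_lt_top_iff_of_pos (by positivity)] at h
    exact h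
  have hb := hbound _ hg.enorm
  have hTfin : ∀ᵐ x, maximalE ν m a (fun y => ‖g y‖ₑ) x < ∞ := by
    have h1 := ae_lt_top (((measurable_maximalE ν m a hg.enorm).pow_const p).mul hUm)
      (lt_of_le_of_lt hb (ENNReal.mul_lt_top hKt.lt_top hlt)).ne
    filter_upwards [h1, hU0] with x hx hx0
    have h2 := ENNReal.lt_top_of_mul_ne_top_left hx.ne hx0
    exact (ENNReal.rpow_lt_top_iff_of_pos hp0).1 h2
  have hloc : localMaximal ν m a f = localMaximal ν m a g := by
    funext x
    simp only [localMaximal, poisson_congr_ae hfg]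
  obtain ⟨h1, h2, h3⟩ := localMaximal_of_maximalE_lt_top hν hg hTfin
  refine ⟨?_, by rw [hloc]; exact h2, ?_⟩
  · filter_upwards [h1] with x hx t ht
    exact (poissonConverges_congr_ae hfg t x).2 (hx t ht)
  · rw [hnorm, hint, hloc, eLpNorm_withDensity_eq hUm hUt hp0, ENNReal.coe_toNNReal
      (ENNReal.rpow_ne_top_of_nonneg (by positivity) hKt),
      ← ENNReal.mul_rpow_of_nonneg _ _ (by positivity)]
    refine ENNReal.rpow_le_rpow (le_trans (lintegral_mono_ae ?_) hb) (by positivity)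
    filter_upwards [h3] with x hx
    rw [enorm_eq_self]
    gcongr

theorem lintegral_extremal_lt_top_of_maximalBounded {m : ℝ} (hm : -(d : ℝ) ≤ m) {ν : ℝ}
    (hν : 0 < ν) {p : ℝ} (hp : 1 < p) {a : ℝ} (ha : 0 < a) {w v : (E d) → ℝ} {W : (E d) → ℝ≥0∞}
    (hW : Measurable W) (hW0 : ∀ x, W x ≠ 0) (hWt : ∀ x, W x ≠ ∞)
    (hwW : ∀ᵐ x, ENNReal.ofReal (w x) = W x) (hv : IsWeight v)
    (hbdd : MaximalBounded ν m a p w v) :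
    ∫⁻ y, extremal ν m p W y * ENNReal.ofReal (phi ν m y) < ∞ := by
  have hp0 : 0 < p := by linarith
  obtain ⟨C, hC⟩ := hbdd
  obtain ⟨V, hV, hV0, hVt, hvV'⟩ := hv.exists_measurable
  have hvV : ∀ᵐ x, ENNReal.ofReal (v x) = V x := hvV'.mono fun x hx => hx.2
  rw [weightMeasure_eq hwW, weightMeasure_eq hvV] at hC
  obtain ⟨c, hc, hlow⟩ := le_poissonE (d := d) hν hm (half_pos ha)
  have ht : a / 2 ∈ Ioo 0 a := ⟨by linarith, by linarith⟩
  set ψ := extremal ν m p W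
  have hψ : Measurable ψ := measurable_extremal hW
  have hψt : ∀ y, ψ y ≠ ∞ := extremal_ne_top hW0 hp
  -- Truncation makes the pairing `I n` finite, so that it can be cancelled from the testing
  -- inequality; the bound obtained is free of `n`.
  set S : ℕ → Set (E d) := fun n => Metric.closedBall 0 n ∩ {y | ψ y ≤ n} with hSdef
  have hS : ∀ n, MeasurableSet (S n) := fun n =>
    Metric.isClosed_closedBall.measurableSet.inter (measurableSet_le hψ measurable_const)
  set I : ℕ → ℝ≥0∞ := fun n => ∫⁻ y in S n, ψ y * ENNReal.ofReal (phi ν m y) with hI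
  set D := Metric.closedBall (0 : E d) 1
  set Q := ∫⁻ x in D, V x with hQdef
  have hQ : Q ≠ 0 := by
    rw [hQdef, Ne, lintegral_eq_zero_iff hV]
    intro h
    have h1 : volume D = 0 := by
      rw [← Measure.restrict_apply_univ]
      exact measure_mono_null (fun x _ => hV0 x) (ae_iff.1 h)
    exact (Metric.measure_closedBall_pos volume (0 : E d) one_pos).ne' h1
  have hc0 : ENNReal.ofReal c ^ p * Q ≠ 0 := by
    refine mul_ne_zero ?_ hQ
    rw [Ne, ENNReal.rpow_eq_zero_iff_of_pos hp0]
    simpa using hc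
  have hIfin : ∀ n, I n < ∞ := by
    intro n
    calc I n ≤ ∫⁻ y in S n, (n : ℝ≥0∞) := by
          refine setLIntegral_mono' (hS n) fun y hy => ?_
          refine (mul_le_of_le_one_right zero_le ?_).trans hy.2
          exact ENNReal.ofReal_le_one.2 (phi_le_one hν m y)
      _ = n * volume (S n) := setLIntegral_const _ _
      _ ≤ n * volume (Metric.closedBall (0 : E d) n) :=
          mul_le_mul_right (measure_mono inter_subset_left) _
      _ < ∞ := ENNReal.mul_lt_top (ENNReal.natCast_lt_top n) measure_closedBall_lt_top
  have hIbound : ∀ n, I n ≤ ((C : ℝ≥0∞) ^ p / (ENNReal.ofReal c ^ p * Q)) ^ (1 / (p - 1)) := by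
    intro n
    set F := (S n).indicator ψ with hF
    have hFm : Measurable F := hψ.indicator (hS n)
    have hFt : ∀ y, F y ≠ ∞ := fun y =>
      ((indicator_le_self (S n) ψ y).trans_lt (hψt y).lt_top).ne
    have hFI : ∫⁻ y, F y * ENNReal.ofReal (phi ν m y) = I n := by
      simp only [hI]
      rw [← lintegral_indicator (hS n)]
      refine lintegral_congr fun y => ?_
      by_cases hy : y ∈ S n
      · simp only [hF, indicator_of_mem hy]
      · simp only [hF, indicator_of_notMem hy, zero_mul]
    have hFW : ∫⁻ y, F y ^ p * W y = I n := by
      simp only [hI]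
      rw [← lintegral_indicator (hS n)]
      refine lintegral_congr fun y => ?_
      by_cases hy : y ∈ S n
      · simp only [hF, indicator_of_mem hy]
        exact extremal_rpow_mul hW0 hWt hp y
      · simp only [hF, indicator_of_notMem hy, ENNReal.zero_rpow_of_pos hp0, zero_mul]
    set g : (E d) → ℝ := fun y => (F y).toReal
    have hg : Measurable g := hFm.ennreal_toReal
    have hgF : ∀ y, ENNReal.ofReal (g y) = F y := fun y => ENNReal.ofReal_toReal (hFt y)
    have hg0 : ∀ y, 0 ≤ g y := fun y => ENNReal.toReal_nonneg
    have hgn : ∀ y, ‖(g y : ℂ)‖ₑ = F y := fun y => by rw [enorm_complex_ofReal (hg0 y), hgF]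
    have hnorm : eLpNorm (fun y => (g y : ℂ)) (ENNReal.ofReal p) (volume.withDensity W) =
        I n ^ (1 / p) := by
      rw [eLpNorm_withDensity_eq hW hWt hp0]
      simp only [hgn, hFW]
    obtain ⟨hconv, -, hle⟩ := hC (fun y => (g y : ℂ))
      ⟨(Complex.measurable_ofReal.comp hg).aestronglyMeasurable, by
        rw [hnorm]; exact ENNReal.rpow_lt_top_of_nonneg (by positivity) (hIfin n).ne⟩
    rw [hnorm, eLpNorm_withDensity_eq hV hVt hp0] at hle
    have hle' := ENNReal.rpow_le_rpow hle hp0.le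
    rw [ENNReal.mul_rpow_of_nonneg _ _ hp0.le, ← ENNReal.rpow_mul, ← ENNReal.rpow_mul,
      one_div_mul_cancel hp0.ne', ENNReal.rpow_one, ENNReal.rpow_one] at hle'
    -- The unit ball alone, with `t = a/2`, bounds the norm of the maximal function from below:
    -- there it is at least `c I n`.
    have hlower : (ENNReal.ofReal c * I n) ^ p * Q ≤ (C : ℝ≥0∞) ^ p * I n := by
      refine le_trans ?_ hle'
      rw [hQdef, ← lintegral_const_mul _ hV]
      refine le_trans (setLIntegral_mono_ae' Metric.isClosed_closedBall.measurableSet ?_)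
        (setLIntegral_le_lintegral D _)
      filter_upwards [hconv] with x hx hxD
      refine mul_le_mul_left (ENNReal.rpow_le_rpow ?_ hp0.le) _
      have h1 := hlow F hFm x (mem_closedBall_zero_iff.1 hxD)
      have h2 := enorm_poisson_ofReal hν (half_pos ha) hg hg0 (hx _ ht)
      simp only [hgF] at h2
      rw [hFI] at h1
      rw [enorm_eq_self]
      refine (h1.trans_eq h2.symm).trans ?_
      exact le_iSup₂ (f := fun (t : ℝ) (_ : t ∈ Ioo (0 : ℝ) a) =>
        ‖poisson ν m t (fun y => (g y : ℂ)) x‖ₑ) (a / 2) ht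
    rcases eq_or_ne (I n) 0 with hI0 | hI0
    · rw [hI0]; exact zero_le
    have hIp : I n ^ p = I n * I n ^ (p - 1) := by
      nth_rw 2 [← ENNReal.rpow_one (I n)]
      rw [← ENNReal.rpow_add_of_nonneg _ _ zero_le_one (by linarith), add_sub_cancel]
    have hcancel : I n * (I n ^ (p - 1) * (ENNReal.ofReal c ^ p * Q)) ≤ I n * (C : ℝ≥0∞) ^ p := by
      refine le_trans (le_of_eq ?_) (hlower.trans_eq (mul_comm _ _))
      rw [ENNReal.mul_rpow_of_nonneg _ _ hp0.le, hIp]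
      ring
    rw [ENNReal.mul_le_mul_iff_right hI0 (hIfin n).ne] at hcancel
    -- The mass `Q` of `v` on the unit ball may be infinite, so finiteness of `C ^ p` is what
    -- licenses the division.
    have hdiv := (ENNReal.le_div_iff_mul_le (Or.inl hc0) (Or.inr
      (ENNReal.rpow_ne_top_of_nonneg hp0.le ENNReal.coe_ne_top))).2 hcancel
    rw [one_div, ENNReal.le_rpow_inv_iff (by linarith)]
    exact hdiv
  have hmono : Monotone S := fun i j hij y hy =>
    ⟨Metric.closedBall_subset_closedBall (Nat.cast_le.2 hij) hy.1,
      le_trans (show ψ y ≤ i from hy.2) (Nat.cast_le.2 hij)⟩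
  have hunion : ⋃ n, S n = univ := by
    refine eq_univ_of_forall fun y => ?_
    obtain ⟨n₁, h₁⟩ := exists_nat_ge ‖y‖
    obtain ⟨n₂, h₂⟩ := ENNReal.exists_nat_gt (hψt y)
    refine mem_iUnion.2 ⟨max n₁ n₂, mem_closedBall_zero_iff.2 (h₁.trans ?_), h₂.le.trans ?_⟩
    · exact Nat.cast_le.2 (le_max_left _ _)
    · exact Nat.cast_le.2 (le_max_right _ _)
  calc ∫⁻ y, ψ y * ENNReal.ofReal (phi ν m y) = ⨆ n, I n := by
        rw [← setLIntegral_univ, ← hunion, setLIntegral_iUnion_of_directed _ hmono.directed_le]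
    _ ≤ ((C : ℝ≥0∞) ^ p / (ENNReal.ofReal c ^ p * Q)) ^ (1 / (p - 1)) := iSup_le hIbound
    _ < ∞ := ENNReal.rpow_lt_top_of_nonneg (one_div_nonneg.2 (by linarith))
        (ENNReal.div_ne_top (ENNReal.rpow_ne_top_of_nonneg hp0.le ENNReal.coe_ne_top) hc0)

end Weights

end HermitePoisson

end

theorem theorem2 (d : ℕ) (hd : 1 ≤ d) (m : ℝ) (hm : -(d : ℝ) ≤ m) (ν : ℝ) (hν : 0 < ν)
    (p : ℝ) (hp : 1 < p) (a : ℝ) (ha : 0 < a)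
    (w : EuclideanSpace ℝ (Fin d) → ℝ) (hw : HermitePoisson.IsWeight w) :
    eLpNorm (fun x => w x ^ (-(1 / p)) * HermitePoisson.phi ν m x)
        (ENNReal.ofReal (p / (p - 1))) volume < ∞ ↔
      ∃ v : EuclideanSpace ℝ (Fin d) → ℝ,
        HermitePoisson.IsWeight v ∧ HermitePoisson.MaximalBounded ν m a p w v := by
  obtain ⟨W, hW, hW0, hWt, hwW⟩ := hw.exists_measurable
  have hwW' := hwW.mono fun x hx => hx.2
  rw [HermitePoisson.eLpNorm_lt_top_iff_extremal hp hwW]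
  constructor
  · exact HermitePoisson.exists_weight_maximalBounded hd hm hν hp a hW hW0 hWt hwW'
  · rintro ⟨v, hv, hbdd⟩
    exact HermitePoisson.lintegral_extremal_lt_top_of_maximalBounded hm hν hp ha hW hW0 hWt hwW'
      hv hbdd
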